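/- All graphs are simple, with a non-empty vertex set, possibly infinite and not necessarily connected. A graph $G$ is regarded as a metric space: every edge is identified with the interval $[0,1]$, the points of $G$ are its vertices and the points in the interior of its edges, and the distance between two points is the length of a shortest path joining them ($\infty$ if there is none). A geodesic joining $x$ and $y$ is (the image of) a curve $\gamma:[0,L]\to G$ with $\gamma(0)=x$, $\gamma(L)=y$ and $d(\gamma(s),\gamma(t))=|s-t|$ for all $s,t\in[0,L]$. A geodesic triangle $T$ consists of three points $x,y,z$ and three geodesics $[xy]$, $[yz]$, $[zx]$ (its sides); $\delta(T)$ is the infimum of the $\delta\ge 0$ such that every point of each side is at distance at most $\delta$ from the union of the other two sides. The hyperbolicity constant is $\delta(G)=\sup\{\delta(T): T \text{ a geodesic triangle in } G\}$. The join $G_1\uplus G_2$ of two graphs with disjoint vertex sets is obtained from their union by adding all edges between $V(G_1)$ and $V(G_2)$. A graph is empty if it has no edges, $E_1$ is the graph with one vertex, and $\Delta_G=\sup_{v\in V(G)}\deg(v)\in\mathbb{N}\cup\{\infty\}$ is the maximum degree of $G$. Theorem. Let $G_1,G_2$ be two graphs. (1) $\delta(G_1\uplus G_2)=0$ if and only if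 $G_1$ and $G_2$ are empty graphs and one of them is isomorphic to $E_1$. (2) $\delta(G_1\uplus G_2)=3/4$ if and only if $G_1\simeq E_1$ and $\Delta_{G_2}=1$, or $G_2\simeq E_1$ and $\Delta_{G_1}=1$. -/

import Mathlib

open scoped ENNReal

noncomputable section

namespace JoinHyp

/-! ### Hyperbolicity constant of a metric space -/

section Hyperbolic

variable {X : Type*} [EMetricSpace X]

/-- `S` is (the image of) a geodesic `[xy]`: a curve `γ : [0, L] → X` from `x` to `y` with
`d(γ(s), γ(t)) = |s - t|` for all `s, t` (so that every subarc has length `|s - t|` too). -/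
def IsGeodesicSegment (x y : X) (S : Set X) : Prop :=
  ∃ (L : ℝ) (γ : ℝ → X), 0 ≤ L ∧ γ 0 = x ∧ γ L = y ∧
    (∀ s ∈ Set.Icc (0 : ℝ) L, ∀ t ∈ Set.Icc (0 : ℝ) L,
      edist (γ s) (γ t) = ENNReal.ofReal |s - t|) ∧
    S = γ '' Set.Icc (0 : ℝ) L

/-- `A`, `B`, `C` are the sides `[xy]`, `[yz]`, `[zx]` of a geodesic triangle. -/
def IsGeodesicTriangle (A B C : Set X) : Prop :=
  ∃ x y z : X, IsGeodesicSegment x y A ∧ IsGeodesicSegment y z B ∧ IsGeodesicSegment z x C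

/-- Every point of a side is at distance at most `δ` from the union of the other two sides. -/
def IsThin (δ : ℝ≥0∞) (A B C : Set X) : Prop :=
  (∀ p ∈ A, Metric.infEDist p (B ∪ C) ≤ δ) ∧
  (∀ p ∈ B, Metric.infEDist p (C ∪ A) ≤ δ) ∧
  (∀ p ∈ C, Metric.infEDist p (A ∪ B) ≤ δ)

/-- The sharp thin constant of a triangle. -/
def thinConstant (A B C : Set X) : ℝ≥0∞ := sInf {δ : ℝ≥0∞ | IsThin δ A B C}

variable (X) in
/-- The sharp hyperbolicity constant: the supremum of the thin constants of all geodesic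
triangles. (For a non-connected metric graph this is the supremum over the components, since
the sides of a geodesic triangle lie in one component.) -/
def hyperbolicityConstant : ℝ≥0∞ :=
  ⨆ (A : Set X) (B : Set X) (C : Set X) (_ : IsGeodesicTriangle A B C), thinConstant A B C

end Hyperbolic

/-! ### A graph as a metric space -/

section MetricGraph

open Classical in
/-- The points of a graph all of whose edges are identified with `[0, 1]`, in barycentric
coordinates: the point at distance `t` from `u` on the edge `[u, v]` has coordinate `1 - t` at
`u`, coordinate `t` at `v`, and `0` elsewhere; the case `u = v` gives the vertex `u`. -/
@[ext]
structure MetricGraph {V : Type*} (G : SimpleGraph V) where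
  coord : V → ℝ
  exists_edge : ∃ (u v : V) (t : ℝ), (u = v ∨ G.Adj u v) ∧ 0 ≤ t ∧ t ≤ 1 ∧
    coord = Pi.single u (1 - t) + Pi.single v t

namespace MetricGraph

variable {V : Type*} {G : SimpleGraph V}

/-- `[p, q]` is an edge that contains both points `x` and `y`. -/
def OnEdge (x y : MetricGraph G) (p q : V) : Prop :=
  G.Adj p q ∧ (∀ w, x.coord w ≠ 0 → w = p ∨ w = q) ∧ (∀ w, y.coord w ≠ 0 → w = p ∨ w = q)

/-- The distance between `x` and `y` inside a common edge (`∞` if there is none). -/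
def innerDist (x y : MetricGraph G) : ℝ≥0∞ :=
  ⨅ (p : V) (q : V) (_ : OnEdge x y p q), ENNReal.ofReal |x.coord p - y.coord p|

/-- The length of a shortest path from `x` to `y` through vertices: it goes from `x` to a
vertex `a` of the edge of `x` (or `x = a`), along a shortest walk to a vertex `b` of the edge
of `y`, and then to `y`. The distance from `x` to `a` in their edge is `1 - x.coord a`. -/
def outerDist (x y : MetricGraph G) : ℝ≥0∞ :=
  ⨅ (a : V) (b : V) (_ : x.coord a ≠ 0 ∧ y.coord b ≠ 0),
    (ENNReal.ofReal (1 - x.coord a) + ((G.edist a b : ℕ∞) : ℝ≥0∞) +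
      ENNReal.ofReal (1 - y.coord b))

/-- The path distance: the length of a shortest path (`∞` between different components). -/
instance : EDist (MetricGraph G) := ⟨fun x y => innerDist x y ⊓ outerDist x y⟩

theorem edist_def (x y : MetricGraph G) : edist x y = innerDist x y ⊓ outerDist x y := rfl

theorem coord_nonneg (x : MetricGraph G) (w : V) : 0 ≤ x.coord w := by
  classical
  obtain ⟨u, v, t, -, h0, h1, h⟩ := x.exists_edge
  rw [h]
  simp only [Pi.add_apply, Pi.single_apply]
  split_ifs <;> linarith

theorem coord_le_one (x : MetricGraph G) (w : V) : x.coord w ≤ 1 := by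
  classical
  obtain ⟨u, v, t, -, h0, h1, h⟩ := x.exists_edge
  rw [h]
  simp only [Pi.add_apply, Pi.single_apply]
  split_ifs <;> linarith

theorem exists_coord_ne_zero (x : MetricGraph G) : ∃ w, x.coord w ≠ 0 := by
  classical
  obtain ⟨u, v, t, -, h0, h1, h⟩ := x.exists_edge
  rcases eq_or_lt_of_le h0 with h2 | h2
  · refine ⟨u, ?_⟩
    rw [h]
    subst h2
    simp
  · refine ⟨v, ?_⟩
    rw [h]
    simp only [Pi.add_apply, Pi.single_apply]
    split_ifs <;> linarith

theorem adj_and_add_eq_one (x : MetricGraph G) {a b : V} (ha : x.coord a ≠ 0)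
    (hb : x.coord b ≠ 0) (hab : a ≠ b) : G.Adj a b ∧ x.coord a + x.coord b = 1 := by
  classical
  obtain ⟨u, v, t, hadj, h0, h1, h⟩ := x.exists_edge
  rw [h] at ha hb ⊢
  simp only [Pi.add_apply, Pi.single_apply] at ha hb ⊢
  have hsymm := fun h : G.Adj u v => h.symm
  grind

theorem add_eq_one (x : MetricGraph G) {p q : V} (hpq : p ≠ q)
    (h : ∀ w, x.coord w ≠ 0 → w = p ∨ w = q) : x.coord p + x.coord q = 1 := by
  classical
  obtain ⟨u, v, t, hadj, h0, h1, hx⟩ := x.exists_edge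
  have hu := h u
  have hv := h v
  rw [hx] at hu hv ⊢
  simp only [Pi.add_apply, Pi.single_apply] at hu hv ⊢
  grind

theorem OnEdge.symm {x y : MetricGraph G} {p q : V} (h : OnEdge x y p q) : OnEdge y x p q :=
  ⟨h.1, h.2.2, h.2.1⟩

theorem OnEdge.swap {x y : MetricGraph G} {p q : V} (h : OnEdge x y p q) : OnEdge x y q p :=
  ⟨h.1.symm, fun w hw => (h.2.1 w hw).symm, fun w hw => (h.2.2 w hw).symm⟩

theorem OnEdge.abs_swap {x y : MetricGraph G} {p q : V} (h : OnEdge x y p q) :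
    |x.coord q - y.coord q| = |x.coord p - y.coord p| := by
  have hx := x.add_eq_one h.1.ne h.2.1
  have hy := y.add_eq_one h.1.ne h.2.2
  rw [show x.coord q - y.coord q = -(x.coord p - y.coord p) by linarith, abs_neg]

theorem edist_support (x : MetricGraph G) {a b : V} (ha : x.coord a ≠ 0) (hb : x.coord b ≠ 0) :
    ((G.edist a b : ℕ∞) : ℝ≥0∞) ≤
      ENNReal.ofReal (1 - x.coord a) + ENNReal.ofReal (1 - x.coord b) := by
  by_cases hab : a = b
  · subst hab
    simp
  · obtain ⟨h1, h2⟩ := x.adj_and_add_eq_one ha hb hab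
    rw [SimpleGraph.edist_eq_one_iff_adj.mpr h1, ← ENNReal.ofReal_add
      (by linarith [x.coord_le_one a]) (by linarith [x.coord_le_one b])]
    rw [show 1 - x.coord a + (1 - x.coord b) = 1 by linarith]
    simp

theorem OnEdge.exists_support {x y : MetricGraph G} {p q : V} (h : OnEdge x y p q) {b : V}
    (hb : y.coord b ≠ 0) : ∃ a, x.coord a ≠ 0 ∧
      ENNReal.ofReal (1 - x.coord a) + ((G.edist a b : ℕ∞) : ℝ≥0∞) ≤
        ENNReal.ofReal |x.coord p - y.coord p| + ENNReal.ofReal (1 - y.coord b) := by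
  wlog hbp : b = p generalizing p q
  · have := this h.swap ((h.2.2 b hb).resolve_left hbp)
    rwa [h.abs_swap] at this
  subst hbp
  rw [← ENNReal.ofReal_add (abs_nonneg _) (by linarith [y.coord_le_one b])]
  by_cases hx : x.coord b = 0
  · have hq := x.add_eq_one h.1.ne h.2.1
    refine ⟨q, by intro h0; linarith, ?_⟩
    rw [SimpleGraph.edist_eq_one_iff_adj.mpr h.1.symm]
    rw [show 1 - x.coord q = 0 by linarith, hx, zero_sub, abs_neg, abs_of_nonneg (y.coord_nonneg b)]
    simp
  · refine ⟨b, hx, ?_⟩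
    simp only [SimpleGraph.edist_self, ENat.toENNReal_zero, add_zero]
    apply ENNReal.ofReal_le_ofReal
    linarith [neg_abs_le (x.coord b - y.coord b)]

theorem innerDist_comm (x y : MetricGraph G) : innerDist x y = innerDist y x := by
  unfold innerDist
  refine iInf_congr fun p => iInf_congr fun q =>
    iInf_congr_Prop ⟨OnEdge.symm, OnEdge.symm⟩ fun _ => ?_
  rw [abs_sub_comm]

theorem outerDist_comm (x y : MetricGraph G) : outerDist x y = outerDist y x := by
  unfold outerDist
  rw [iInf_comm]
  refine iInf_congr fun b => iInf_congr fun a => iInf_congr_Prop and_comm fun _ => ?_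
  rw [SimpleGraph.edist_comm]
  ring

theorem outerDist_le {x y : MetricGraph G} {a b : V} (ha : x.coord a ≠ 0) (hb : y.coord b ≠ 0) :
    outerDist x y ≤ ENNReal.ofReal (1 - x.coord a) + ((G.edist a b : ℕ∞) : ℝ≥0∞) +
      ENNReal.ofReal (1 - y.coord b) :=
  iInf_le_of_le a (iInf_le_of_le b (iInf_le _ ⟨ha, hb⟩))

theorem innerDist_le {x y : MetricGraph G} {p q : V} (h : OnEdge x y p q) :
    innerDist x y ≤ ENNReal.ofReal |x.coord p - y.coord p| :=
  iInf_le_of_le p (iInf_le_of_le q (iInf_le _ h))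

theorem edist_triangle_cast (a b c : V) : ((G.edist a c : ℕ∞) : ℝ≥0∞) ≤
    ((G.edist a b : ℕ∞) : ℝ≥0∞) + ((G.edist b c : ℕ∞) : ℝ≥0∞) := by
  exact_mod_cast ENat.toENNReal_le.mpr (SimpleGraph.edist_triangle (G := G) (u := a) (v := b) (w := c))

theorem outer_outer (x y z : MetricGraph G) : outerDist x z ≤ outerDist x y + outerDist y z := by
  conv_rhs => unfold outerDist
  simp only [ENNReal.iInf_add, ENNReal.add_iInf]
  simp only [le_iInf_iff]
  rintro b' c ⟨hb', hc⟩ a b ⟨ha, hb⟩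
  refine (outerDist_le ha hc).trans ?_
  have h1 := edist_triangle_cast (G := G) a b c
  have h2 := edist_triangle_cast (G := G) b b' c
  have h3 := y.edist_support hb hb'
  calc _ ≤ ENNReal.ofReal (1 - x.coord a) + (((G.edist a b : ℕ∞) : ℝ≥0∞) +
        ((ENNReal.ofReal (1 - y.coord b) + ENNReal.ofReal (1 - y.coord b')) +
          ((G.edist b' c : ℕ∞) : ℝ≥0∞))) + ENNReal.ofReal (1 - z.coord c) := by
        gcongr
        exact h1.trans (add_le_add le_rfl (h2.trans (add_le_add h3 le_rfl)))
    _ = _ := by ring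

theorem inner_outer (x y z : MetricGraph G) : outerDist x z ≤ innerDist x y + outerDist y z := by
  conv_rhs => unfold outerDist innerDist
  simp only [ENNReal.iInf_add, ENNReal.add_iInf]
  simp only [le_iInf_iff]
  rintro b c ⟨hb, hc⟩ p q h
  obtain ⟨a, ha, hle⟩ := h.exists_support hb
  refine (outerDist_le ha hc).trans ?_
  have h1 := edist_triangle_cast (G := G) a b c
  calc _ ≤ ENNReal.ofReal (1 - x.coord a) + (((G.edist a b : ℕ∞) : ℝ≥0∞) +
          ((G.edist b c : ℕ∞) : ℝ≥0∞)) + ENNReal.ofReal (1 - z.coord c) := by gcongr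
    _ = (ENNReal.ofReal (1 - x.coord a) + ((G.edist a b : ℕ∞) : ℝ≥0∞)) +
          ((G.edist b c : ℕ∞) : ℝ≥0∞) + ENNReal.ofReal (1 - z.coord c) := by ring
    _ ≤ _ := by
        refine (add_le_add (add_le_add hle le_rfl) le_rfl).trans_eq ?_
        ring

theorem inner_inner (x y z : MetricGraph G) : edist x z ≤ innerDist x y + innerDist y z := by
  by_cases hv : ∃ r, y.coord r = 1
  · obtain ⟨r, hr⟩ := hv
    have h : outerDist x y ≤ innerDist x y := by
      conv_rhs => unfold innerDist
      simp only [le_iInf_iff]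
      intro p q h
      have hr0 : y.coord r ≠ 0 := by rw [hr]; norm_num
      obtain ⟨a, ha, hle⟩ := h.exists_support hr0
      refine (outerDist_le ha hr0).trans ?_
      rw [hr] at hle ⊢
      simpa using hle
    rw [edist_def]
    refine inf_le_right.trans ?_
    rw [outerDist_comm]
    refine (inner_outer z y x).trans ?_
    rw [outerDist_comm, innerDist_comm z y, add_comm]
    gcongr
  · conv_rhs => unfold innerDist
    simp only [ENNReal.iInf_add, ENNReal.add_iInf]
    simp only [le_iInf_iff]
    intro p' q' h' p q h
    have hpq := y.add_eq_one h.1.ne h.2.2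
    have hp : y.coord p ≠ 0 := fun h0 => hv ⟨q, by linarith⟩
    have hq : y.coord q ≠ 0 := fun h0 => hv ⟨p, by linarith⟩
    have hp' := h'.2.1 p hp
    have hq' := h'.2.1 q hq
    have key : OnEdge x z p q ∧ |y.coord p' - z.coord p'| = |y.coord p - z.coord p| := by
      have hne := h.1.ne
      refine ⟨⟨h.1, h.2.1, fun w hw => ?_⟩, ?_⟩
      · have := h'.2.2 w hw
        grind
      · have hab := h'.abs_swap
        grind
    rw [edist_def, key.2, ← ENNReal.ofReal_add (abs_nonneg _) (abs_nonneg _)]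
    refine inf_le_left.trans ((innerDist_le key.1).trans (ENNReal.ofReal_le_ofReal ?_))
    exact abs_sub_le _ _ _

theorem eq_of_coord_eq_one {x y : MetricGraph G} {a : V} (hx : x.coord a = 1)
    (hy : y.coord a = 1) : x = y := by
  have aux : ∀ z : MetricGraph G, z.coord a = 1 → ∀ w, w ≠ a → z.coord w = 0 := by
    intro z hz w hw
    by_contra h
    have := (z.adj_and_add_eq_one h (by rw [hz]; norm_num) hw).2
    exact h (by linarith)
  ext w
  by_cases hw : w = a
  · rw [hw, hx, hy]
  · rw [aux x hx w hw, aux y hy w hw]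

theorem edist_self_eq (x : MetricGraph G) : edist x x = 0 := by
  obtain ⟨a, ha⟩ := x.exists_coord_ne_zero
  rw [edist_def, ← nonpos_iff_eq_zero]
  by_cases h1 : x.coord a = 1
  · refine inf_le_right.trans ((outerDist_le ha ha).trans ?_)
    simp [h1]
  · classical
    obtain ⟨u, v, t, hadj, h0, h1', h⟩ := x.exists_edge
    rcases hadj with rfl | hadj
    · rw [h] at ha h1
      simp only [Pi.add_apply, Pi.single_apply] at ha h1
      grind
    · have hon : OnEdge x x u v := by
        have : ∀ w, x.coord w ≠ 0 → w = u ∨ w = v := by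
          intro w hw
          rw [h] at hw
          simp only [Pi.add_apply, Pi.single_apply] at hw
          grind
        exact ⟨hadj, this, this⟩
      refine inf_le_left.trans ((innerDist_le hon).trans ?_)
      simp

theorem eq_of_edist_eq_zero' {x y : MetricGraph G} (h : edist x y = 0) : x = y := by
  classical
  have hfin : ∀ z : MetricGraph G, {w | z.coord w ≠ 0}.Finite := by
    intro z
    obtain ⟨u, v, t, -, -, -, hz⟩ := z.exists_edge
    refine (Set.toFinite {u, v}).subset fun w hw => ?_
    simp only [Set.mem_ofPred_eq, hz, Pi.add_apply, Pi.single_apply] at hw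
    simp only [Set.mem_insert_iff, Set.mem_singleton_iff]
    grind
  rw [edist_def, ← nonpos_iff_eq_zero, inf_le_iff] at h
  rcases h with h | h
  · have hall : ∀ w, x.coord w = y.coord w := by
      intro w
      by_contra hne
      have : ENNReal.ofReal |x.coord w - y.coord w| ≤ innerDist x y := by
        unfold innerDist
        simp only [le_iInf_iff]
        intro p q hpq
        have hs := hpq.abs_swap
        have h1 := hpq.2.1 w
        have h2 := hpq.2.2 w
        have : w = p ∨ w = q := by grind
        rcases this with rfl | rfl
        · exact le_rfl
        · rw [hs]
      have h3 := this.trans h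
      rw [nonpos_iff_eq_zero, ENNReal.ofReal_eq_zero, abs_nonpos_iff, sub_eq_zero] at h3
      exact hne h3
    exact MetricGraph.ext (funext hall)
  · have hpos : ∃ a b, (x.coord a ≠ 0 ∧ y.coord b ≠ 0) ∧
        ENNReal.ofReal (1 - x.coord a) + ((G.edist a b : ℕ∞) : ℝ≥0∞) +
          ENNReal.ofReal (1 - y.coord b) = 0 := by
      have hS : ({w | x.coord w ≠ 0} ×ˢ {w | y.coord w ≠ 0}).Finite := (hfin x).prod (hfin y)
      obtain ⟨a0, ha0⟩ := x.exists_coord_ne_zero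
      obtain ⟨b0, hb0⟩ := y.exists_coord_ne_zero
      obtain ⟨⟨a, b⟩, hab, hmin⟩ := hS.exists_minimalFor (fun r : V × V =>
        ENNReal.ofReal (1 - x.coord r.1) + ((G.edist r.1 r.2 : ℕ∞) : ℝ≥0∞) +
          ENNReal.ofReal (1 - y.coord r.2)) _ ⟨(a0, b0), ha0, hb0⟩
      refine ⟨a, b, hab, ?_⟩
      rw [← nonpos_iff_eq_zero]
      refine le_trans ?_ h
      unfold outerDist
      simp only [le_iInf_iff]
      intro a' b' hab'
      rcases le_total
        (ENNReal.ofReal (1 - x.coord a) + ((G.edist a b : ℕ∞) : ℝ≥0∞) +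
          ENNReal.ofReal (1 - y.coord b))
        (ENNReal.ofReal (1 - x.coord a') + ((G.edist a' b' : ℕ∞) : ℝ≥0∞) +
          ENNReal.ofReal (1 - y.coord b')) with hle | hle
      · exact hle
      · exact hmin (j := (a', b')) hab' hle
    obtain ⟨a, b, -, h0⟩ := hpos
    simp only [add_eq_zero, ENNReal.ofReal_eq_zero, ENat.toENNReal_eq_zero,
      SimpleGraph.edist_eq_zero_iff] at h0
    obtain ⟨⟨h1, rfl⟩, h2⟩ := h0
    exact eq_of_coord_eq_one (a := a) (le_antisymm (x.coord_le_one a) (by linarith))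
      (le_antisymm (y.coord_le_one a) (by linarith))

theorem edist_comm' (x y : MetricGraph G) : edist x y = edist y x := by
  rw [edist_def, edist_def, innerDist_comm, outerDist_comm]

theorem edist_triangle' (x y z : MetricGraph G) : edist x z ≤ edist x y + edist y z := by
  rw [edist_def x y, edist_def y z]
  rcases min_choice (innerDist x y) (outerDist x y) with h1 | h1 <;>
    rcases min_choice (innerDist y z) (outerDist y z) with h2 | h2 <;> rw [h1, h2]
  · exact inner_inner x y z
  · exact inf_le_right.trans (inner_outer x y z)
  · refine inf_le_right.trans ?_
    rw [outerDist_comm x z, outerDist_comm x y, innerDist_comm y z, add_comm]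
    exact inner_outer z y x
  · exact inf_le_right.trans (outer_outer x y z)

/-- A graph, as a metric space with the path distance. -/
instance : EMetricSpace (MetricGraph G) where
  edist_self := edist_self_eq
  edist_comm := edist_comm'
  edist_triangle := edist_triangle'
  eq_of_edist_eq_zero := eq_of_edist_eq_zero'

end MetricGraph

end MetricGraph

/-! ### Notions about graphs -/

section Graph

variable {V W : Type*}

/-- The hyperbolicity constant `δ(G)` of a graph. -/
def graphDelta (G : SimpleGraph V) : ℝ≥0∞ := hyperbolicityConstant (MetricGraph G)

/-- The join of two graphs: their disjoint union together with all edges between them. -/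
def graphJoin (G : SimpleGraph V) (H : SimpleGraph W) : SimpleGraph (V ⊕ W) :=
  (G ⊕g H) ⊔ completeBipartiteGraph V W

/-- The maximum degree: the supremum of the degrees of the vertices. -/
def supDegree (G : SimpleGraph V) : ℕ∞ := ⨆ v : V, (G.neighborSet v).encard

/-- The graph with one vertex. -/
def oneVertexGraph : SimpleGraph (Fin 1) := ⊥

end Graph

end JoinHyp

end

namespace JoinHyp

/-! ### Geodesics and general bounds for the hyperbolicity constant -/

section Geodesic

variable {X : Type*} [EMetricSpace X]

/-! The constant of a join is `0`, `3 / 4` or at least `1`, and a few small subgraphs decide which.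

If both factors have two vertices, the join contains a 4-cycle. The midpoints of two opposite edges
are then at distance 2 and are joined by a geodesic along either remaining edge; the midpoint of one
of these geodesics is at distance at least 1 from the other, with or without chords
(`one_le_graphDelta`).

Otherwise one factor is a single vertex `o`, and the join is a cone over the other factor `H`
(`graphDelta_cone`). There are three cases. If `H` has no edges, the cone is a star, a tree: Gromov
products based at `o` are ultrametric, which gives the four-point condition and the constant `0`
(`graphDelta_eq_zero_of_star`). If a vertex of `H` has two neighbours, these three vertices and `o`
form a 4-cycle, so the constant is at least `1`. If `H` has an edge and all degrees are at most 1,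
the cone is a windmill: triangles and edges glued at the cut point `o`. A triangle forces at least
`3 / 4` (`three_quarters_le_graphDelta`). Conversely each block has diameter at most `3 / 2`, and a
point of a side far from both endpoints is close to `o`, which also lies on another side; this gives
at most `3 / 4` (`graphDelta_le_of_isWindmill`). -/

theorem IsGeodesicSegment.left_mem {x y : X} {S : Set X} (h : IsGeodesicSegment x y S) :
    x ∈ S := by
  obtain ⟨L, γ, hL, h0, -, -, rfl⟩ := h
  exact ⟨0, ⟨le_rfl, hL⟩, h0⟩

theorem IsGeodesicSegment.symm {x y : X} {S : Set X} (h : IsGeodesicSegment x y S) :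
    IsGeodesicSegment y x S := by
  obtain ⟨L, γ, hL, h0, h1, hd, rfl⟩ := h
  refine ⟨L, fun t => γ (L - t), hL, by simpa using h1, by simpa using h0, ?_, ?_⟩
  · intro s hs t ht
    rw [hd _ ⟨by linarith [hs.2], by linarith [hs.1]⟩ _ ⟨by linarith [ht.2], by linarith [ht.1]⟩]
    rw [show L - s - (L - t) = -(s - t) by ring, abs_neg]
  · ext p
    constructor
    · rintro ⟨s, hs, rfl⟩
      exact ⟨L - s, ⟨by linarith [hs.2], by linarith [hs.1]⟩, by simp⟩
    · rintro ⟨s, hs, rfl⟩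
      exact ⟨L - s, ⟨by linarith [hs.2], by linarith [hs.1]⟩, rfl⟩

theorem IsGeodesicSegment.right_mem {x y : X} {S : Set X} (h : IsGeodesicSegment x y S) :
    y ∈ S := h.symm.left_mem

theorem isGeodesicSegment_singleton (x : X) : IsGeodesicSegment x x {x} := by
  refine ⟨0, fun _ => x, le_rfl, rfl, rfl, ?_, ?_⟩
  · intro s hs t ht
    have h1 : s = 0 := le_antisymm hs.2 hs.1
    have h2 : t = 0 := le_antisymm ht.2 ht.1
    simp [h1, h2]
  · simp

/-- The concatenation of two geodesics is a geodesic when the lengths add up. -/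
theorem IsGeodesicSegment.union {x y z : X} {A B : Set X} (hA : IsGeodesicSegment x y A)
    (hB : IsGeodesicSegment y z B) (h : edist x y + edist y z ≤ edist x z) :
    IsGeodesicSegment x z (A ∪ B) := by
  obtain ⟨L, γ, hL, rfl, rfl, hd, rfl⟩ := hA
  obtain ⟨M, η, hM, hη, rfl, he, rfl⟩ := hB
  have hlen1 : edist (γ 0) (γ L) = ENNReal.ofReal L := by
    rw [hd 0 ⟨le_rfl, hL⟩ L ⟨hL, le_rfl⟩, zero_sub, abs_neg, abs_of_nonneg hL]
  have hlen2 : edist (γ L) (η M) = ENNReal.ofReal M := by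
    rw [← hη, he 0 ⟨le_rfl, hM⟩ M ⟨hM, le_rfl⟩, zero_sub, abs_neg, abs_of_nonneg hM]
  rw [hlen1, hlen2, ← ENNReal.ofReal_add hL hM] at h
  set θ : ℝ → X := fun t => if t ≤ L then γ t else η (t - L) with hθ
  have hθ1 : ∀ t, t ≤ L → θ t = γ t := fun t ht => if_pos ht
  have hθ2 : ∀ t, L ≤ t → θ t = η (t - L) := by
    intro t ht
    rcases eq_or_lt_of_le ht with rfl | ht
    · rw [hθ1 _ le_rfl, sub_self, hη]
    · exact if_neg (not_le.mpr ht)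
  have hup : ∀ s t, 0 ≤ s → s ≤ t → t ≤ L + M → edist (θ s) (θ t) ≤ ENNReal.ofReal (t - s) := by
    intro s t hs hst ht
    rcases le_total t L with h1 | h1
    · rw [hθ1 t h1, hθ1 s (hst.trans h1), hd s ⟨hs, hst.trans h1⟩ t ⟨hs.trans hst, h1⟩,
        abs_sub_comm, abs_of_nonneg (by linarith)]
    · rcases le_total s L with h2 | h2
      · refine (edist_triangle _ (γ L) _).trans ?_
        rw [hθ1 s h2, hd s ⟨hs, h2⟩ L ⟨hL, le_rfl⟩, hθ2 t h1, ← hη,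
          he 0 ⟨le_rfl, hM⟩ (t - L) ⟨by linarith, by linarith⟩,
          ← ENNReal.ofReal_add (abs_nonneg _) (abs_nonneg _)]
        apply ENNReal.ofReal_le_ofReal
        rw [abs_sub_comm s L, abs_of_nonneg (by linarith), zero_sub, abs_neg,
          abs_of_nonneg (by linarith)]
        linarith
      · rw [hθ2 s h2, hθ2 t h1, he _ ⟨by linarith, by linarith⟩ _ ⟨by linarith, by linarith⟩,
          abs_sub_comm, abs_of_nonneg (by linarith)]
        apply ENNReal.ofReal_le_ofReal
        linarith
  have heq : ∀ s t, 0 ≤ s → s ≤ t → t ≤ L + M → edist (θ s) (θ t) = ENNReal.ofReal (t - s) := by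
    intro s t hs hst ht
    refine le_antisymm (hup s t hs hst ht) ?_
    -- A shortcut between `θ s` and `θ t`, combined with the upper bounds on the two outer arcs,
    -- would bring the endpoints closer than `L + M`.
    by_contra hlt
    rw [not_le] at hlt
    have h1 := hup 0 s le_rfl hs (hst.trans ht)
    have h2 := hup t (L + M) (hs.trans hst) ht le_rfl
    have h3 : ENNReal.ofReal (L + M) ≤ edist (θ 0) (θ (L + M)) := by
      rw [hθ1 0 hL, hθ2 (L + M) (by linarith), add_sub_cancel_left]
      exact h
    have h4 : edist (θ 0) (θ (L + M)) ≤
        ENNReal.ofReal (s - 0) + edist (θ s) (θ t) + ENNReal.ofReal (L + M - t) :=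
      (edist_triangle4 _ (θ s) (θ t) _).trans (by gcongr)
    have h5 : ENNReal.ofReal (s - 0) + edist (θ s) (θ t) + ENNReal.ofReal (L + M - t) <
        ENNReal.ofReal (s - 0) + ENNReal.ofReal (t - s) + ENNReal.ofReal (L + M - t) := by
      refine ENNReal.add_lt_add_right ENNReal.ofReal_ne_top ?_
      exact ENNReal.add_lt_add_left ENNReal.ofReal_ne_top hlt
    rw [← ENNReal.ofReal_add (by linarith) (by linarith),
      ← ENNReal.ofReal_add (by linarith) (by linarith),
      show s - 0 + (t - s) + (L + M - t) = L + M by ring] at h5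
    exact absurd (h3.trans h4) (not_le.mpr h5)
  refine ⟨L + M, θ, by linarith, hθ1 0 hL, ?_, ?_, ?_⟩
  · rw [hθ2 _ (by linarith), add_sub_cancel_left]
  · intro s hs t ht
    rcases le_total s t with hst | hst
    · rw [heq s t hs.1 hst ht.2, abs_sub_comm, abs_of_nonneg (by linarith)]
    · rw [edist_comm, heq t s ht.1 hst hs.2, abs_of_nonneg (by linarith)]
  · ext p
    constructor
    · rintro (⟨s, hs, rfl⟩ | ⟨s, hs, rfl⟩)
      · exact ⟨s, ⟨hs.1, by linarith [hs.2]⟩, hθ1 s hs.2⟩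
      · refine ⟨L + s, ⟨by linarith [hs.1], by linarith [hs.2]⟩, ?_⟩
        rw [hθ2 _ (by linarith [hs.1]), add_sub_cancel_left]
    · rintro ⟨s, hs, rfl⟩
      rcases le_total s L with h1 | h1
      · exact Or.inl ⟨s, ⟨hs.1, h1⟩, (hθ1 s h1).symm⟩
      · exact Or.inr ⟨s - L, ⟨by linarith, by linarith [hs.2]⟩, (hθ2 s h1).symm⟩

/-- Distances along a geodesic, as real numbers. -/
theorem IsGeodesicSegment.toReal_add {x y p : X} {S : Set X} (h : IsGeodesicSegment x y S)
    (hp : p ∈ S) :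
    (edist x p).toReal + (edist p y).toReal = (edist x y).toReal := by
  obtain ⟨L, γ, hL, rfl, rfl, hd, rfl⟩ := h
  obtain ⟨s, hs, rfl⟩ := hp
  rw [hd 0 ⟨le_rfl, hL⟩ s hs, hd s hs L ⟨hL, le_rfl⟩, hd 0 ⟨le_rfl, hL⟩ L ⟨hL, le_rfl⟩,
    ENNReal.toReal_ofReal (abs_nonneg _), ENNReal.toReal_ofReal (abs_nonneg _),
    ENNReal.toReal_ofReal (abs_nonneg _), zero_sub, zero_sub, abs_neg, abs_neg,
    abs_of_nonneg hL, abs_of_nonneg hs.1, abs_sub_comm, abs_of_nonneg (by linarith [hs.2])]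
  ring

theorem IsGeodesicSegment.exists_toReal_eq {x y : X} {S : Set X} (h : IsGeodesicSegment x y S)
    {r : ℝ} (h0 : 0 ≤ r) (hr : r ≤ (edist x y).toReal) :
    ∃ q ∈ S, (edist x q).toReal = r := by
  obtain ⟨L, γ, hL, rfl, rfl, hd, rfl⟩ := h
  rw [hd 0 ⟨le_rfl, hL⟩ L ⟨hL, le_rfl⟩, ENNReal.toReal_ofReal (abs_nonneg _), zero_sub, abs_neg,
    abs_of_nonneg hL] at hr
  refine ⟨γ r, ⟨r, ⟨h0, hr⟩, rfl⟩, ?_⟩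
  rw [hd 0 ⟨le_rfl, hL⟩ r ⟨h0, hr⟩, ENNReal.toReal_ofReal (abs_nonneg _), zero_sub, abs_neg,
    abs_of_nonneg h0]

/-- Cyclic rotation of the three sides reduces thinness to a condition on the first side, with a
nearby point as witness instead of an infimum. -/
theorem hyperbolicityConstant_le {δ : ℝ≥0∞}
    (h : ∀ (x y z : X) (A B C : Set X), IsGeodesicSegment x y A → IsGeodesicSegment y z B →
      IsGeodesicSegment z x C → ∀ p ∈ A, ∃ q ∈ B ∪ C, edist p q ≤ δ) :
    hyperbolicityConstant X ≤ δ := by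
  have key : ∀ (x y z : X) (A B C : Set X), IsGeodesicSegment x y A → IsGeodesicSegment y z B →
      IsGeodesicSegment z x C → ∀ p ∈ A, Metric.infEDist p (B ∪ C) ≤ δ := by
    intro x y z A B C hA hB hC p hp
    obtain ⟨q, hq, hpq⟩ := h x y z A B C hA hB hC p hp
    exact (Metric.infEDist_le_edist_of_mem hq).trans hpq
  unfold hyperbolicityConstant
  simp only [iSup_le_iff]
  rintro A B C ⟨x, y, z, hA, hB, hC⟩
  exact sInf_le ⟨key x y z A B C hA hB hC, key y z x B C A hB hC hA, key z x y C A B hC hA hB⟩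

/-- A geodesic bigon bounds the hyperbolicity constant from below. -/
theorem le_hyperbolicityConstant {δ : ℝ≥0∞} {x y m : X} {A B : Set X}
    (hA : IsGeodesicSegment x y A) (hB : IsGeodesicSegment y x B) (hm : m ∈ A)
    (h : ∀ q ∈ B, δ ≤ edist m q) : δ ≤ hyperbolicityConstant X := by
  -- The bigon is a triangle whose third side is the constant geodesic at `x`, a point already on
  -- `B`.
  have hT : IsGeodesicTriangle A B {x} := ⟨x, y, x, hA, hB, isGeodesicSegment_singleton x⟩
  have h1 : thinConstant A B {x} ≤ hyperbolicityConstant X := by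
    unfold hyperbolicityConstant
    exact le_iSup_of_le A (le_iSup_of_le B (le_iSup_of_le {x} (le_iSup_of_le hT le_rfl)))
  refine le_trans (le_sInf ?_) h1
  rintro ε ⟨hε, -, -⟩
  refine le_trans (Metric.le_infEDist.mpr ?_) (hε m hm)
  rintro q (hq | hq)
  · exact h q hq
  · rw [Set.mem_singleton_iff] at hq
    exact h q (hq ▸ hB.right_mem)

theorem toReal_edist_triangle (hfin : ∀ x y : X, edist x y ≠ ⊤) (x y z : X) :
    (edist x z).toReal ≤ (edist x y).toReal + (edist y z).toReal := by
  rw [← ENNReal.toReal_add (hfin _ _) (hfin _ _)]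
  exact ENNReal.toReal_mono (ENNReal.add_ne_top.mpr ⟨hfin _ _, hfin _ _⟩) (edist_triangle x y z)

theorem eq_of_toReal_edist_nonpos (hfin : ∀ x y : X, edist x y ≠ ⊤) {x y : X}
    (h : (edist x y).toReal ≤ 0) : x = y := by
  have h0 : (edist x y).toReal = 0 := le_antisymm h ENNReal.toReal_nonneg
  rw [ENNReal.toReal_eq_zero_iff] at h0
  exact edist_eq_zero.mp (h0.resolve_right (hfin _ _))

/-- Spaces with the four-point property of trees have hyperbolicity constant `0`. -/
theorem hyperbolicityConstant_eq_zero_of_four_point (hfin : ∀ x y : X, edist x y ≠ ⊤)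
    (h4 : ∀ a b c e : X, (edist a b).toReal + (edist c e).toReal ≤
      max ((edist a c).toReal + (edist b e).toReal) ((edist a e).toReal + (edist b c).toReal)) :
    hyperbolicityConstant X = 0 := by
  -- The inequality says that `p` is no further from `x` than the Gromov product of `y` and `z` at
  -- `x`; up to that distance the two sides leaving `x` coincide.
  have key : ∀ (x y z p : X) (A C : Set X), IsGeodesicSegment x y A → IsGeodesicSegment x z C →
      p ∈ A → 2 * (edist x p).toReal + (edist y z).toReal ≤
        (edist x y).toReal + (edist x z).toReal → p ∈ C := by
    intro x y z p A C hA hC hp hle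
    have h1 := hA.toReal_add hp
    have h2 := toReal_edist_triangle hfin x z y
    rw [edist_comm z y] at h2
    obtain ⟨q, hq, hqd⟩ := hC.exists_toReal_eq (r := (edist x p).toReal) ENNReal.toReal_nonneg
      (by linarith)
    have h3 := hC.toReal_add hq
    -- The four-point condition is used twice: `h6` bounds the distance from `q` to `y` by that from
    -- `p` to `y`, and then `h5` forces `p` and `q` to coincide.
    have h5 := h4 p q x y
    have h6 := h4 q y x z
    rw [edist_comm p x, edist_comm q x] at h5
    rw [edist_comm q x, edist_comm y x] at h6
    have h7 : (edist q y).toReal ≤ (edist x y).toReal - (edist x p).toReal := by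
      rcases max_choice ((edist x q).toReal + (edist y z).toReal)
        ((edist q z).toReal + (edist x y).toReal) with h | h <;> rw [h] at h6 <;> linarith
    have h8 : (edist p q).toReal ≤ 0 := by
      rcases max_choice ((edist x p).toReal + (edist q y).toReal)
        ((edist p y).toReal + (edist x q).toReal) with h | h <;> rw [h] at h5 <;> linarith
    rw [eq_of_toReal_edist_nonpos hfin h8]
    exact hq
  rw [← nonpos_iff_eq_zero]
  refine hyperbolicityConstant_le fun x y z A B C hA hB hC p hp => ⟨p, ?_, by simp⟩
  have h1 := hA.toReal_add hp
  -- The Gromov products at `x` and at `y` add up to the length of `A`, so `p` lies within one of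
  -- them from the corresponding end.
  rcases le_total (2 * (edist x p).toReal + (edist y z).toReal)
    ((edist x y).toReal + (edist x z).toReal) with h | h
  · exact Or.inr (key x y z p A C hA hC.symm hp h)
  · refine Or.inl (key y x z p A B hA.symm hB hp ?_)
    rw [edist_comm y p, edist_comm y x]
    linarith

/-- A space whose blocks meet at the cut point `o`, where blocks have diameter at most `2 r`,
has hyperbolicity constant at most `r`. The relation `S` says that two points share a block. -/
theorem hyperbolicityConstant_le_of_cut_point (hfin : ∀ x y : X, edist x y ≠ ⊤) (o : X)
    (S : X → X → Prop) (hsymm : ∀ x y, S x y → S y x)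
    (htrans : ∀ x q y, q ≠ o → S x q → S q y → S x y) {r : ℝ}
    (hcut : ∀ x y, ¬ S x y → (edist x y).toReal = (edist x o).toReal + (edist o y).toReal)
    (ho : ∀ x, (edist x o).toReal ≤ 2 * r) (hS : ∀ x y, S x y → (edist x y).toReal ≤ 2 * r) :
    hyperbolicityConstant X ≤ ENNReal.ofReal r := by
  -- A geodesic between different blocks contains `o`: its point `q` at distance `d(x, o)` from `x`
  -- is separated by `o` from `x` or from `y`, and the additivity of distances leaves no room
  -- between `q` and `o`.
  have hmem : ∀ x y A, IsGeodesicSegment x y A → ¬ S x y → o ∈ A := by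
    intro x y A hA hxy
    have h0 := hcut x y hxy
    obtain ⟨q, hq, hqd⟩ := hA.exists_toReal_eq (r := (edist x o).toReal) ENNReal.toReal_nonneg
      (by linarith [ENNReal.toReal_nonneg (a := edist o y)])
    have h1 := hA.toReal_add hq
    by_cases hqo : q = o
    · exact hqo ▸ hq
    by_cases h2 : S x q
    · have h3 : ¬ S q y := fun h3 => hxy (htrans x q y hqo h2 h3)
      have h4 := hcut q y h3
      exact absurd (eq_of_toReal_edist_nonpos hfin (by linarith)) hqo
    · have h4 := hcut x q h2
      exact absurd (eq_of_toReal_edist_nonpos hfin (by linarith)).symm hqo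
  have hle : ∀ p q : X, (edist p q).toReal ≤ r → edist p q ≤ ENNReal.ofReal r := fun p q h =>
    (ENNReal.le_ofReal_iff_toReal_le (hfin p q) (ENNReal.toReal_nonneg.trans h)).mpr h
  refine hyperbolicityConstant_le fun x y z A B C hA hB hC p hp => ?_
  have h1 := hA.toReal_add hp
  by_cases h2 : (edist p x).toReal ≤ r
  · exact ⟨x, Or.inr hC.right_mem, hle _ _ h2⟩
  by_cases h3 : (edist p y).toReal ≤ r
  · exact ⟨y, Or.inl hB.left_mem, hle _ _ h3⟩
  rw [not_le] at h2 h3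
  have hpx := edist_comm p x
  have hxy : ¬ S x y := fun h => by
    have := hS x y h
    rw [hpx] at h2
    linarith
  -- Since `x` and `y` lie in different blocks, either `z = o` or `z` is in a different block from
  -- one of them.
  have hoBC : o ∈ B ∪ C := by
    by_cases hz : z = o
    · exact Or.inl (hz ▸ hB.right_mem)
    by_cases h4 : S y z
    · refine Or.inr (hmem z x C hC fun h5 => hxy ?_)
      exact hsymm _ _ (htrans y z x hz h4 h5)
    · exact Or.inl (hmem y z B hB h4)
  refine ⟨o, hoBC, hle _ _ ?_⟩
  have hcxy := hcut x y hxy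
  have hox := ho x
  have hoy := ho y
  by_cases hpo : p = o
  · subst hpo
    rw [hpx] at h2
    rw [edist_self, ENNReal.toReal_zero]
    linarith [hpx]
  -- Either `p` lies between `x` and `o`, or between `o` and `y`. That portion has length at most `2
  -- * r`, and `p` is more than `r` away from its outer end.
  by_cases h6 : S x p
  · have h7 : ¬ S p y := fun h7 => hxy (htrans x p y hpo h6 h7)
    have h8 := hcut p y h7
    rw [hpx] at h2
    linarith
  · have h8 := hcut x p h6
    rw [edist_comm o p] at h8
    rw [edist_comm o y] at hcxy
    linarith

end Geodesic

end JoinHyp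

/-! ### Distance estimates and edge segments in a metric graph -/

noncomputable section

namespace JoinHyp

namespace MetricGraph

variable {V : Type*} {G : SimpleGraph V}

/-- The routes to be excluded are of three kinds: inside a common edge, through a shared endpoint,
and through distinct endpoints, where the walk costs at least 1. -/
theorem le_edist_of {x y : MetricGraph G} {r : ℝ}
    (hin : ∀ p q, OnEdge x y p q → r ≤ |x.coord p - y.coord p|)
    (hsame : ∀ a, x.coord a ≠ 0 → y.coord a ≠ 0 → r ≤ 2 - x.coord a - y.coord a)
    (hdiff : ∀ a b, x.coord a ≠ 0 → y.coord b ≠ 0 → a ≠ b → r ≤ 3 - x.coord a - y.coord b) :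
    ENNReal.ofReal r ≤ edist x y := by
  rw [edist_def, le_inf_iff]
  constructor
  · unfold innerDist
    simp only [le_iInf_iff]
    exact fun p q h => ENNReal.ofReal_le_ofReal (hin p q h)
  · unfold outerDist
    simp only [le_iInf_iff]
    rintro a b ⟨ha, hb⟩
    have h1 := x.coord_le_one a
    have h2 := y.coord_le_one b
    by_cases hab : a = b
    · subst hab
      rw [SimpleGraph.edist_self, ENat.toENNReal_zero, add_zero,
        ← ENNReal.ofReal_add (by linarith) (by linarith)]
      exact ENNReal.ofReal_le_ofReal (by linarith [hsame a ha hb])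
    · have h3 : (1 : ℝ≥0∞) ≤ ((G.edist a b : ℕ∞) : ℝ≥0∞) := by
        have : (1 : ℕ∞) ≤ G.edist a b :=
          Order.one_le_iff_pos.mpr (SimpleGraph.edist_pos_of_ne hab)
        exact_mod_cast ENat.toENNReal_le.mpr this
      calc ENNReal.ofReal r ≤ ENNReal.ofReal (1 - x.coord a + 1 + (1 - y.coord b)) :=
            ENNReal.ofReal_le_ofReal (by linarith [hdiff a b ha hb hab])
        _ = ENNReal.ofReal (1 - x.coord a) + 1 + ENNReal.ofReal (1 - y.coord b) := by
            rw [ENNReal.ofReal_add (by linarith) (by linarith),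
              ENNReal.ofReal_add (by linarith) (by linarith), ENNReal.ofReal_one]
        _ ≤ _ := by gcongr

/-- Barycentric coordinates are 1-Lipschitz, a cheap source of lower bounds for distances. -/
theorem abs_coord_sub_le_edist (x y : MetricGraph G) (a : V) :
    ENNReal.ofReal |x.coord a - y.coord a| ≤ edist x y := by
  have aux : ∀ (z : MetricGraph G) c, c ≠ a → z.coord c ≠ 0 → z.coord a ≤ 1 - z.coord c := by
    intro z c hca hc
    by_cases ha : z.coord a = 0
    · rw [ha]
      linarith [z.coord_le_one c]
    · linarith [(z.adj_and_add_eq_one ha hc hca.symm).2]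
  have hx0 := x.coord_nonneg a
  have hy0 := y.coord_nonneg a
  have hx1 := x.coord_le_one a
  have hy1 := y.coord_le_one a
  apply le_edist_of
  · intro p q h
    by_cases hap : a = p
    · rw [hap]
    by_cases haq : a = q
    · rw [haq, h.abs_swap]
    · have h1 : x.coord a = 0 := by
        by_contra h1
        rcases h.2.1 a h1 with h2 | h2 <;> contradiction
      have h2 : y.coord a = 0 := by
        by_contra h1
        rcases h.2.2 a h1 with h2 | h2 <;> contradiction
      simp [h1, h2]
  · intro c hxc hyc
    rw [abs_le]
    by_cases hca : c = a
    · subst hca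
      constructor <;> linarith
    · have h1 := aux x c hca hxc
      have h2 := aux y c hca hyc
      have := x.coord_le_one c
      have := y.coord_le_one c
      constructor <;> linarith
  · intro c b _ _ _
    have := x.coord_le_one c
    have := y.coord_le_one b
    rw [abs_le]
    constructor <;> linarith

theorem edist_le_of_ne_zero {x y : MetricGraph G} {a b : V} (ha : x.coord a ≠ 0)
    (hb : y.coord b ≠ 0) :
    edist x y ≤ ENNReal.ofReal (1 - x.coord a) + ((G.edist a b : ℕ∞) : ℝ≥0∞) +
      ENNReal.ofReal (1 - y.coord b) := by
  rw [edist_def]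
  exact inf_le_right.trans (outerDist_le ha hb)

theorem edist_le_of_common {x y : MetricGraph G} {a : V} (ha : x.coord a ≠ 0)
    (hb : y.coord a ≠ 0) : edist x y ≤ ENNReal.ofReal (2 - x.coord a - y.coord a) := by
  refine (edist_le_of_ne_zero ha hb).trans_eq ?_
  rw [SimpleGraph.edist_self, ENat.toENNReal_zero, add_zero,
    ← ENNReal.ofReal_add (by linarith [x.coord_le_one a]) (by linarith [y.coord_le_one a])]
  congr 1
  ring

theorem edist_le_of_adj {x y : MetricGraph G} {a b : V} (ha : x.coord a ≠ 0)
    (hb : y.coord b ≠ 0) (hab : G.Adj a b) :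
    edist x y ≤ ENNReal.ofReal (3 - x.coord a - y.coord b) := by
  have h1 := x.coord_le_one a
  have h2 := y.coord_le_one b
  refine (edist_le_of_ne_zero ha hb).trans_eq ?_
  rw [SimpleGraph.edist_eq_one_iff_adj.mpr hab, ENat.toENNReal_one, ← ENNReal.ofReal_one,
    ← ENNReal.ofReal_add (by linarith) (by norm_num),
    ← ENNReal.ofReal_add (by linarith) (by linarith)]
  congr 1
  ring

theorem edist_le_of_onEdge {x y : MetricGraph G} {p q : V} (h : OnEdge x y p q) :
    edist x y ≤ ENNReal.ofReal |x.coord p - y.coord p| := by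
  rw [edist_def]
  exact inf_le_left.trans (innerDist_le h)

/-- A point has a coordinate that is at least `1 / 2`. -/
theorem exists_half_le_coord (x : MetricGraph G) : ∃ a, 1 / 2 ≤ x.coord a := by
  classical
  obtain ⟨u, v, t, -, h0, h1, h⟩ := x.exists_edge
  rcases le_total t (1 / 2) with ht | ht
  · refine ⟨u, ?_⟩
    rw [h]
    simp only [Pi.add_apply, Pi.single_apply]
    split_ifs <;> linarith
  · refine ⟨v, ?_⟩
    rw [h]
    simp only [Pi.add_apply, Pi.single_apply]
    split_ifs <;> linarith

/-- If a point is not a vertex, its support is an edge. -/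
theorem exists_ne_zero_of_ne_one (x : MetricGraph G) {a : V} (h1 : x.coord a ≠ 1) :
    ∃ b, b ≠ a ∧ x.coord b ≠ 0 := by
  by_contra! hne
  obtain ⟨u, v, t, hadj, -, -, h⟩ := x.exists_edge
  have hs : ∀ w, w ≠ a → x.coord w = 0 := hne
  rcases hadj with rfl | hadj
  · have h2 := hs u
    have h3 : x.coord u = 1 := by rw [h]; simp
    by_cases hu : u = a
    · exact h1 (hu ▸ h3)
    · rw [h2 hu] at h3
      norm_num at h3
  · obtain ⟨c, hac, hc⟩ : ∃ c, c ≠ a ∧ (c = u ∨ c = v) := by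
      by_cases hu : u = a
      · exact ⟨v, fun hv => hadj.ne (hu.trans hv.symm), Or.inr rfl⟩
      · exact ⟨u, hu, Or.inl rfl⟩
    by_cases hcu : c = u
    · obtain ha | ha : a = v ∨ a ≠ v := eq_or_ne a v
      · have hu0 : x.coord u = 0 := hs u (hcu ▸ hac)
        have h4 : x.coord u + x.coord v = 1 := by
          rw [h]
          simp [hadj.ne, hadj.ne']
        exact h1 (by rw [ha]; linarith)
      · have hu0 : x.coord u = 0 := hs u (hcu ▸ hac)
        have hv0 : x.coord v = 0 := hs v ha.symm
        have h4 : x.coord u + x.coord v = 1 := by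
          rw [h]
          simp [hadj.ne, hadj.ne']
        linarith
    · have hcv : c = v := hc.resolve_left hcu
      have hv0 : x.coord v = 0 := hs v (hcv ▸ hac)
      have h4 : x.coord u + x.coord v = 1 := by
        rw [h]
        simp [hadj.ne, hadj.ne']
      by_cases ha : u = a
      · exact h1 (by rw [← ha]; linarith)
      · linarith [hs u ha]

/-- The point at distance `t` from `p` on the edge `[p, q]`, for `t ∈ [0, 1]`. -/
def edgePoint {p q : V} (h : G.Adj p q) (t : ℝ) : MetricGraph G := by
  classical
  -- Clamping `t` to the unit interval makes the parametrization total on `ℝ`, as the curve of a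
  -- geodesic segment has to be.
  exact ⟨Pi.single p (1 - max 0 (min 1 t)) + Pi.single q (max 0 (min 1 t)),
    p, q, max 0 (min 1 t), Or.inr h, le_max_left _ _,
    max_le zero_le_one (min_le_left _ _), by congr⟩

section EdgePoint

variable {p q : V} (h : G.Adj p q) {t : ℝ}

theorem edgePoint_coord_left (ht : t ∈ Set.Icc (0 : ℝ) 1) :
    (edgePoint h t).coord p = 1 - t := by
  simp [edgePoint, h.ne, min_eq_right ht.2, max_eq_right ht.1]

theorem edgePoint_coord_right (ht : t ∈ Set.Icc (0 : ℝ) 1) :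
    (edgePoint h t).coord q = t := by
  simp [edgePoint, h.ne', min_eq_right ht.2, max_eq_right ht.1]

theorem edgePoint_coord_of_ne {w : V} (hp : w ≠ p) (hq : w ≠ q) :
    (edgePoint h t).coord w = 0 := by
  simp [edgePoint, hp, hq]

theorem edgePoint_support {w : V} (hw : (edgePoint h t).coord w ≠ 0) : w = p ∨ w = q := by
  by_contra hne
  rw [not_or] at hne
  exact hw (edgePoint_coord_of_ne h hne.1 hne.2)

theorem edist_edgePoint {s : ℝ} (hs : s ∈ Set.Icc (0 : ℝ) 1) (ht : t ∈ Set.Icc (0 : ℝ) 1) :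
    edist (edgePoint h s) (edgePoint h t) = ENNReal.ofReal |s - t| := by
  have hon : OnEdge (edgePoint h s) (edgePoint h t) q p :=
    ⟨h.symm, fun w hw => (edgePoint_support h hw).symm, fun w hw => (edgePoint_support h hw).symm⟩
  have h1 := edist_le_of_onEdge hon
  have h2 := abs_coord_sub_le_edist (edgePoint h s) (edgePoint h t) q
  rw [edgePoint_coord_right h hs, edgePoint_coord_right h ht] at h1 h2
  exact le_antisymm h1 h2

theorem edgePoint_symm (ht : t ∈ Set.Icc (0 : ℝ) 1) :
    edgePoint h.symm t = edgePoint h (1 - t) := by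
  have ht' : 1 - t ∈ Set.Icc (0 : ℝ) 1 := ⟨by linarith [ht.2], by linarith [ht.1]⟩
  ext w
  by_cases hp : w = p
  · subst hp
    rw [edgePoint_coord_right h.symm ht, edgePoint_coord_left h ht']
    ring
  by_cases hq : w = q
  · subst hq
    rw [edgePoint_coord_left h.symm ht, edgePoint_coord_right h ht']
  · rw [edgePoint_coord_of_ne _ hq hp, edgePoint_coord_of_ne _ hp hq]

/-- An initial segment of an edge is a geodesic. -/
theorem isGeodesicSegment_edge (ht : t ∈ Set.Icc (0 : ℝ) 1) :
    IsGeodesicSegment (edgePoint h 0) (edgePoint h t) (edgePoint h '' Set.Icc 0 t) :=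
  ⟨t, edgePoint h, ht.1, rfl, rfl, fun _ hs _ hs' =>
    edist_edgePoint h ⟨hs.1, hs.2.trans ht.2⟩ ⟨hs'.1, hs'.2.trans ht.2⟩, rfl⟩

/-- Needed for gluing edge segments: a vertex is the same point whichever edge presents it. -/
theorem edgePoint_zero_eq {r : V} (h' : G.Adj p r) : edgePoint h 0 = edgePoint h' 0 := by
  have h0 : (0 : ℝ) ∈ Set.Icc (0 : ℝ) 1 := ⟨le_rfl, zero_le_one⟩
  refine eq_of_coord_eq_one (a := p) ?_ ?_ <;> rw [edgePoint_coord_left _ h0, sub_zero]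

theorem edgePoint_one_eq {r : V} (h' : G.Adj q r) : edgePoint h 1 = edgePoint h' 0 := by
  have h0 : (0 : ℝ) ∈ Set.Icc (0 : ℝ) 1 := ⟨le_rfl, zero_le_one⟩
  have h1 : (1 : ℝ) ∈ Set.Icc (0 : ℝ) 1 := ⟨zero_le_one, le_rfl⟩
  refine eq_of_coord_eq_one (a := q) ?_ ?_
  · rw [edgePoint_coord_right _ h1]
  · rw [edgePoint_coord_left _ h0, sub_zero]

end EdgePoint

/-- A path between disjoint supports leaves the first for at least `1 - α`, crosses at least one
whole edge, and enters the second for at least `1 - β`. If the points share an edge, they are its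
two ends, and then `α` and `β` are at least 1. -/
theorem le_edist_of_disjoint {x y : MetricGraph G} {α β r : ℝ}
    (hdis : ∀ w, x.coord w = 0 ∨ y.coord w = 0) (hx : ∀ w, x.coord w ≤ α)
    (hy : ∀ w, y.coord w ≤ β) (hr : r ≤ 3 - α - β) :
    ENNReal.ofReal r ≤ edist x y := by
  apply le_edist_of
  · intro p q h
    have h1 := x.add_eq_one h.1.ne h.2.1
    have h2 := y.add_eq_one h.1.ne h.2.2
    have h3 := hx p
    have h4 := hx q
    have h5 := hy p
    have h6 := hy q
    rcases hdis p with h | h <;> rcases hdis q with h' | h'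
    · linarith
    · rw [h, show y.coord p = 1 by linarith, zero_sub, abs_neg, abs_one]
      linarith
    · rw [h, show x.coord p = 1 by linarith, sub_zero, abs_one]
      linarith
    · linarith
  · intro a ha hb
    rcases hdis a with h | h <;> contradiction
  · intro a b _ _ _
    linarith [hx a, hy b]

end MetricGraph

/-! ### Lower bounds from 4-cycles and triangles -/

section LowerBounds

open MetricGraph

variable {V : Type*} {G : SimpleGraph V}

theorem half_mem : (1 / 2 : ℝ) ∈ Set.Icc (0 : ℝ) 1 := by constructor <;> norm_num

theorem zero_mem_unit : (0 : ℝ) ∈ Set.Icc (0 : ℝ) 1 := by constructor <;> norm_num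

theorem one_mem_unit : (1 : ℝ) ∈ Set.Icc (0 : ℝ) 1 := by constructor <;> norm_num

theorem edgePoint_half_coord_le {p q : V} (h : G.Adj p q) (w : V) :
    (edgePoint h (1 / 2)).coord w ≤ 1 / 2 := by
  by_cases hp : w = p
  · subst hp
    rw [edgePoint_coord_left h half_mem]
    norm_num
  by_cases hq : w = q
  · subst hq
    rw [edgePoint_coord_right h half_mem]
  · rw [edgePoint_coord_of_ne h hp hq]
    norm_num

/-- In a `4`-cycle `a b d c`, the path through `a` and `c` is a geodesic between the midpoints of
`[a, b]` and `[c, d]`. -/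
theorem isGeodesicSegment_of_square {a b c d : V} (hab : G.Adj a b) (hcd : G.Adj c d)
    (hac : G.Adj a c) (had : a ≠ d) (hbc : b ≠ c) (hbd : b ≠ d) :
    IsGeodesicSegment (edgePoint hab (1 / 2)) (edgePoint hcd (1 / 2))
      (edgePoint hab '' Set.Icc 0 (1 / 2) ∪ edgePoint hac '' Set.Icc 0 1 ∪
        edgePoint hcd '' Set.Icc 0 (1 / 2)) := by
  have e1 := (isGeodesicSegment_edge hab half_mem).symm
  have e2 := isGeodesicSegment_edge hac one_mem_unit
  have e3 := isGeodesicSegment_edge hcd half_mem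
  rw [edgePoint_zero_eq hab hac] at e1
  rw [edgePoint_one_eq hac hcd] at e2
  refine (e1.union e2 ?_).union e3 ?_
  · rw [edgePoint_zero_eq hac hab, edist_edgePoint hab half_mem zero_mem_unit,
      edgePoint_zero_eq hab hac, ← edgePoint_one_eq hac hcd,
      edist_edgePoint hac zero_mem_unit one_mem_unit,
      ← ENNReal.ofReal_add (abs_nonneg _) (abs_nonneg _)]
    refine le_edist_of_disjoint (β := 1) (fun w => ?_) (edgePoint_half_coord_le hab)
      (fun w => coord_le_one _ _) (by norm_num [abs_of_pos])
    by_cases hc : w = c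
    · exact Or.inl (edgePoint_coord_of_ne _ (hc ▸ hac.ne') (hc ▸ hbc.symm))
    · right
      by_cases ha : w = a
      · subst ha
        rw [edgePoint_coord_left hac one_mem_unit, sub_self]
      · exact edgePoint_coord_of_ne _ ha hc
  · have h1 : edist (edgePoint hab (1 / 2)) (edgePoint hcd 0) ≤ ENNReal.ofReal (3 / 2) := by
      refine (edist_triangle _ (edgePoint hac 0) _).trans ?_
      rw [edgePoint_zero_eq hac hab, edist_edgePoint hab half_mem zero_mem_unit,
        edgePoint_zero_eq hab hac, ← edgePoint_one_eq hac hcd,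
        edist_edgePoint hac zero_mem_unit one_mem_unit,
        ← ENNReal.ofReal_add (abs_nonneg _) (abs_nonneg _)]
      exact ENNReal.ofReal_le_ofReal (by norm_num [abs_of_pos])
    refine (add_le_add h1 (edist_edgePoint hcd zero_mem_unit half_mem).le).trans ?_
    rw [← ENNReal.ofReal_add (by norm_num) (abs_nonneg _)]
    -- Both midpoints have coordinates at most `1 / 2`, so their distance is at least `3 - 1/2 - 1/2
    -- = 2`, the length of the path.
    refine le_edist_of_disjoint (fun w => ?_) (edgePoint_half_coord_le hab)
      (edgePoint_half_coord_le hcd) (by norm_num [abs_of_pos])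
    by_contra! hne
    have h2 := edgePoint_support _ hne.1
    have h3 := edgePoint_support _ hne.2
    have := hac.ne
    grind

/-- The midpoint of `[a, c]` is far from points that avoid `a` or `c` and are not too close to
the other one. -/
theorem one_le_edist_midpoint {a c : V} (hac : G.Adj a c) {y : MetricGraph G}
    (h0 : y.coord a = 0 ∨ y.coord c = 0) (ha : y.coord a ≤ 1 / 2) (hc : y.coord c ≤ 1 / 2) :
    1 ≤ edist (edgePoint hac (1 / 2)) y := by
  rw [← ENNReal.ofReal_one]
  have hm := edgePoint_half_coord_le hac
  apply le_edist_of
  · intro p q h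
    have h1 := h.2.1 a (by rw [edgePoint_coord_left _ half_mem]; norm_num)
    have h2 := h.2.1 c (by rw [edgePoint_coord_right _ half_mem]; norm_num)
    have h3 := y.add_eq_one h.1.ne h.2.2
    have h4 := hac.ne
    exfalso
    have h5 : y.coord a + y.coord c = 1 := by
      rcases h1 with rfl | rfl <;> rcases h2 with rfl | rfl <;> first | contradiction | linarith
    rcases h0 with h | h <;> linarith
  · intro w hw _
    have h1 := hm w
    rcases edgePoint_support _ hw with rfl | rfl <;> linarith
  · intro w b _ _ _
    linarith [hm w, y.coord_le_one b]

/-- The bigon consists of the geodesics through `[a, c]` and through `[b, d]` joining the midpoints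
of `[a, b]` and `[c, d]`. The cycle need not be induced: chords do not shorten these paths. -/
theorem one_le_graphDelta {a b c d : V} (hab : G.Adj a b) (hbd : G.Adj b d) (hcd : G.Adj c d)
    (hac : G.Adj a c) (had : a ≠ d) (hbc : b ≠ c) : 1 ≤ graphDelta G := by
  have g1 := isGeodesicSegment_of_square hab hcd hac had hbc hbd.ne
  have g2 := (isGeodesicSegment_of_square hab.symm hcd.symm hbd hbc had hac.ne).symm
  rw [edgePoint_symm hab half_mem, edgePoint_symm hcd half_mem,
    show (1 - 1 / 2 : ℝ) = 1 / 2 by norm_num] at g2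
  refine le_hyperbolicityConstant g1 g2 (m := edgePoint hac (1 / 2))
    (Or.inl (Or.inr ⟨1 / 2, half_mem, rfl⟩)) ?_
  rintro q ((⟨t, ht, rfl⟩ | ⟨t, ht, rfl⟩) | ⟨t, ht, rfl⟩)
  · have ht' : t ∈ Set.Icc (0 : ℝ) 1 := ⟨ht.1, by linarith [ht.2]⟩
    have h1 : (edgePoint hab.symm t).coord c = 0 := edgePoint_coord_of_ne _ hbc.symm hac.ne'
    refine one_le_edist_midpoint hac (Or.inr h1) ?_ (by rw [h1]; norm_num)
    rw [edgePoint_coord_right hab.symm ht']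
    exact ht.2
  · have h1 : (edgePoint hbd t).coord a = 0 := edgePoint_coord_of_ne _ hab.ne had
    have h2 : (edgePoint hbd t).coord c = 0 := edgePoint_coord_of_ne _ hbc.symm hcd.ne
    exact one_le_edist_midpoint hac (Or.inl h1) (by rw [h1]; norm_num) (by rw [h2]; norm_num)
  · have ht' : t ∈ Set.Icc (0 : ℝ) 1 := ⟨ht.1, by linarith [ht.2]⟩
    have h1 : (edgePoint hcd.symm t).coord a = 0 := edgePoint_coord_of_ne _ had hac.ne
    refine one_le_edist_midpoint hac (Or.inl h1) (by rw [h1]; norm_num) ?_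
    rw [edgePoint_coord_right hcd.symm ht']
    exact ht.2

/-- In a triangle, a vertex is joined to the midpoint of the opposite edge by a geodesic through
either of the other vertices. -/
theorem isGeodesicSegment_of_triangle {a b c : V} (hab : G.Adj a b) (hbc : G.Adj b c)
    (hac : a ≠ c) :
    IsGeodesicSegment (edgePoint hab 0) (edgePoint hbc (1 / 2))
      (edgePoint hab '' Set.Icc 0 1 ∪ edgePoint hbc '' Set.Icc 0 (1 / 2)) := by
  have e2 := isGeodesicSegment_edge hab one_mem_unit
  have e3 := isGeodesicSegment_edge hbc half_mem
  rw [← edgePoint_one_eq hab hbc] at e3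
  refine e2.union e3 ?_
  rw [edgePoint_one_eq hab hbc, edist_edgePoint hbc zero_mem_unit half_mem,
    ← edgePoint_one_eq hab hbc, edist_edgePoint hab zero_mem_unit one_mem_unit,
    ← ENNReal.ofReal_add (abs_nonneg _) (abs_nonneg _)]
  refine le_edist_of_disjoint (α := 1) (fun w => ?_) (fun w => coord_le_one _ _)
    (edgePoint_half_coord_le hbc) (by norm_num [abs_of_pos])
  by_cases ha : w = a
  · exact Or.inr (edgePoint_coord_of_ne _ (ha ▸ hab.ne) (ha ▸ hac))
  · left
    by_cases hb : w = b
    · subst hb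
      rw [edgePoint_coord_right hab zero_mem_unit]
    · exact edgePoint_coord_of_ne _ ha hb

/-- The bigon joins `a` to the midpoint of `[b, c]` through `b` and through `c`, both of length `3 /
2`. The extremal point is the middle of the first geodesic, at distance `3 / 4` from `a` on `[a,
b]`. -/
theorem three_quarters_le_graphDelta {a b c : V} (hab : G.Adj a b) (hbc : G.Adj b c)
    (hac : G.Adj a c) : 3 / 4 ≤ graphDelta G := by
  have g1 := isGeodesicSegment_of_triangle hab hbc hac.ne
  have g2 := (isGeodesicSegment_of_triangle hac hbc.symm hab.ne).symm
  rw [edgePoint_symm hbc half_mem, show (1 - 1 / 2 : ℝ) = 1 / 2 by norm_num,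
    edgePoint_zero_eq hac hab] at g2
  have hmem : (3 / 4 : ℝ) ∈ Set.Icc (0 : ℝ) 1 := by constructor <;> norm_num
  have h34 : (3 / 4 : ℝ≥0∞) = ENNReal.ofReal (3 / 4) := by
    rw [ENNReal.ofReal_div_of_pos (by norm_num)]
    simp
  rw [h34]
  refine le_hyperbolicityConstant g1 g2 (m := edgePoint hab (3 / 4))
    (Or.inl ⟨3 / 4, hmem, rfl⟩) ?_
  have hma : (edgePoint hab (3 / 4)).coord a = 1 / 4 := by
    rw [edgePoint_coord_left _ hmem]
    norm_num
  have hmb : (edgePoint hab (3 / 4)).coord b = 3 / 4 := edgePoint_coord_right _ hmem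
  rintro q (⟨t, ht, rfl⟩ | ⟨t, ht, rfl⟩)
  -- On `[a, c]` the coordinate at `b` vanishes, and it is `3 / 4` at the chosen point.
  · have h1 : (edgePoint hac t).coord b = 0 := edgePoint_coord_of_ne _ hab.ne' hbc.ne
    refine le_trans ?_ (abs_coord_sub_le_edist _ _ b)
    rw [hmb, h1]
    exact ENNReal.ofReal_le_ofReal (by norm_num [abs_of_pos])
  · have ht' : t ∈ Set.Icc (0 : ℝ) 1 := ⟨ht.1, by linarith [ht.2]⟩
    have h1 : (edgePoint hbc.symm t).coord a = 0 := edgePoint_coord_of_ne _ hac.ne hab.ne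
    have h2 : (edgePoint hbc.symm t).coord b = t := edgePoint_coord_right _ ht'
    have h5 := ht.2
    apply le_edist_of
    · intro p q h
      have h3 := h.2.1 a (by rw [hma]; norm_num)
      have h4 := h.2.1 b (by rw [hmb]; norm_num)
      have h6 := add_eq_one _ h.1.ne h.2.2
      have h7 := hab.ne
      exfalso
      rcases h3 with rfl | rfl <;> rcases h4 with rfl | rfl <;> first | contradiction | linarith
    · intro w hw hw'
      rcases edgePoint_support _ hw with rfl | rfl
      · exact absurd h1 hw'
      · linarith
    · intro w w' hw _ _
      have h6 := coord_le_one (edgePoint hbc.symm t) w'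
      rcases edgePoint_support _ hw with rfl | rfl <;> linarith

end LowerBounds

end JoinHyp

end

/-! ### Graphs with a dominating vertex: windmills and stars -/

noncomputable section

namespace JoinHyp

namespace MetricGraph

variable {V : Type*} {G : SimpleGraph V}

/-- A vertex, as a point of the metric graph. -/
def vertexPoint (G : SimpleGraph V) (o : V) : MetricGraph G := by
  classical
  exact ⟨Pi.single o 1, o, o, 0, Or.inl rfl, le_rfl, zero_le_one, by
    rw [sub_zero, Pi.single_zero, add_zero]⟩

theorem vertexPoint_coord_self (o : V) : (vertexPoint G o).coord o = 1 := by
  simp [vertexPoint]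

theorem vertexPoint_coord_of_ne {o w : V} (h : w ≠ o) : (vertexPoint G o).coord w = 0 := by
  simp [vertexPoint, h]

theorem eq_vertexPoint {x : MetricGraph G} {o : V} (h : ∀ w, w ≠ o → x.coord w = 0) :
    x = vertexPoint G o := by
  have h1 : x.coord o = 1 := by
    by_contra h1
    obtain ⟨b, hb, hb'⟩ := x.exists_ne_zero_of_ne_one h1
    exact hb' (h b hb)
  exact eq_of_coord_eq_one h1 (vertexPoint_coord_self o)

end MetricGraph

section Apex

open MetricGraph

variable {V : Type*} {G : SimpleGraph V} {o : V}

theorem edist_apex_le_of_ne_zero (ho : ∀ v, v ≠ o → G.Adj o v) {x : MetricGraph G} {a : V}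
    (ha : x.coord a ≠ 0) : edist x (vertexPoint G o) ≤ ENNReal.ofReal (2 - x.coord a) := by
  have h1 : (vertexPoint G o).coord o ≠ 0 := by rw [vertexPoint_coord_self]; exact one_ne_zero
  by_cases hao : a = o
  · subst hao
    refine (edist_le_of_common ha h1).trans (ENNReal.ofReal_le_ofReal ?_)
    rw [vertexPoint_coord_self]
    linarith
  · refine (edist_le_of_adj ha h1 (ho a hao).symm).trans (ENNReal.ofReal_le_ofReal ?_)
    rw [vertexPoint_coord_self]
    linarith

/-- Starting towards the nearer end of its edge, a point reaches a vertex within `1 / 2`, and `o` is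
at most one edge further. -/
theorem edist_apex_le (ho : ∀ v, v ≠ o → G.Adj o v) (x : MetricGraph G) :
    edist x (vertexPoint G o) ≤ ENNReal.ofReal (3 / 2) := by
  obtain ⟨a, ha⟩ := x.exists_half_le_coord
  exact (edist_apex_le_of_ne_zero ho (by linarith)).trans
    (ENNReal.ofReal_le_ofReal (by linarith))

theorem edist_ne_top_of_apex (ho : ∀ v, v ≠ o → G.Adj o v) (x y : MetricGraph G) :
    edist x y ≠ ⊤ := by
  refine ne_top_of_le_ne_top (ENNReal.add_ne_top.mpr ⟨?_, ?_⟩)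
    (edist_triangle_right x y (vertexPoint G o)) <;>
  exact ne_top_of_le_ne_top ENNReal.ofReal_ne_top (edist_apex_le ho _)

/-- Two points lie in a common block of a graph with a dominating vertex `o`. -/
def SameBlock (o : V) (x y : MetricGraph G) : Prop :=
  ∀ v w, v ≠ o → w ≠ o → x.coord v ≠ 0 → y.coord w ≠ 0 → v = w ∨ G.Adj v w

theorem SameBlock.symm {x y : MetricGraph G} (h : SameBlock o x y) : SameBlock o y x :=
  fun v w hv hw hv' hw' => (h w v hw hv hw' hv').imp Eq.symm SimpleGraph.Adj.symm

/-- Vertices other than `o` have at most one neighbour other than `o`. -/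
def IsWindmill (G : SimpleGraph V) (o : V) : Prop :=
  ∀ v u w, v ≠ o → u ≠ o → w ≠ o → G.Adj v u → G.Adj v w → u = w

theorem IsWindmill.trans (hG : IsWindmill G o) {u v w : V} (hu : u ≠ o) (hv : v ≠ o) (hw : w ≠ o)
    (h1 : u = v ∨ G.Adj u v) (h2 : v = w ∨ G.Adj v w) : u = w ∨ G.Adj u w := by
  rcases h1 with rfl | h1
  · exact h2
  rcases h2 with rfl | h2
  · exact Or.inr h1
  · exact Or.inl (hG v u w hv hu hw h1.symm h2)

/-- The middle point must differ from `o`, which vacuously shares a block with every point. Any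
other `q` has a support vertex `u ≠ o`, through which equality or adjacency is passed on. -/
theorem SameBlock.trans (hG : IsWindmill G o) {x q y : MetricGraph G}
    (hq : q ≠ vertexPoint G o) (h1 : SameBlock o x q) (h2 : SameBlock o q y) :
    SameBlock o x y := by
  obtain ⟨u, hu, hu'⟩ : ∃ u, u ≠ o ∧ q.coord u ≠ 0 := by
    by_contra! hne
    exact hq (eq_vertexPoint hne)
  intro v w hv hw hv' hw'
  exact hG.trans hv hu hw (h1 v u hv hu hv' hu') (h2 u w hu hw hu' hw')

theorem edist_apex_le_add (x : MetricGraph G) {a : V} (ha : x.coord a ≠ 0) :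
    edist x (vertexPoint G o) ≤
      ENNReal.ofReal (1 - x.coord a) + ((G.edist a o : ℕ∞) : ℝ≥0∞) := by
  have h1 : (vertexPoint G o).coord o ≠ 0 := by rw [vertexPoint_coord_self]; exact one_ne_zero
  refine (edist_le_of_ne_zero ha h1).trans_eq ?_
  rw [vertexPoint_coord_self]
  simp

/-- Distinct non-adjacent vertices are at distance at least 2, which a walk through `o` attains. -/
theorem graph_edist_eq_of_not_adj (ho : ∀ v, v ≠ o → G.Adj o v) {a b : V} (hab : a ≠ b)
    (hadj : ¬ G.Adj a b) : G.edist a o + G.edist o b ≤ G.edist a b := by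
  by_cases ha : a = o
  · subst ha
    simp
  by_cases hb : b = o
  · subst hb
    simp
  rw [SimpleGraph.edist_eq_one_iff_adj.mpr (ho a ha).symm,
    SimpleGraph.edist_eq_one_iff_adj.mpr (ho b hb)]
  have h1 : G.edist a b ≠ 1 := fun h => hadj (SimpleGraph.edist_eq_one_iff_adj.mp h)
  have h2 : G.edist a b ≠ 0 := fun h => hab (SimpleGraph.edist_eq_zero_iff.mp h)
  have h3 : 1 < G.edist a b := lt_of_le_of_ne (Order.one_le_iff_pos.mpr (pos_iff_ne_zero.mpr h2))
    (Ne.symm h1)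
  exact Order.add_one_le_of_lt h3

theorem edist_eq_of_not_sameBlock (ho : ∀ v, v ≠ o → G.Adj o v) (hG : IsWindmill G o)
    {x y : MetricGraph G} (h : ¬ SameBlock o x y) :
    edist x y = edist x (vertexPoint G o) + edist (vertexPoint G o) y := by
  refine le_antisymm (edist_triangle _ _ _) ?_
  unfold SameBlock at h
  push Not at h
  obtain ⟨v, w, hv, hw, hxv, hyw, hne, hadj⟩ := h
  rw [edist_def x y, le_inf_iff]
  constructor
  · unfold innerDist
    simp only [le_iInf_iff]
    intro p q hpq
    exfalso
    have h1 := hpq.2.1 v hxv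
    have h2 := hpq.2.2 w hyw
    have h3 := hpq.1
    have h4 := hpq.1.symm
    rcases h1 with rfl | rfl <;> rcases h2 with rfl | rfl <;> contradiction
  · unfold outerDist
    simp only [le_iInf_iff]
    rintro a b ⟨ha, hb⟩
    -- If neither `a` nor `b` is `o`, they belong to the blocks of `v` and `w`, hence are distinct
    -- and not adjacent, and the detour through `o` costs nothing.
    have key : G.edist a o + G.edist o b ≤ G.edist a b := by
      by_cases hao : a = o
      · subst hao
        simp
      by_cases hbo : b = o
      · subst hbo
        simp
      have hva : v = a ∨ G.Adj v a := by
        by_cases h : v = a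
        · exact Or.inl h
        · exact Or.inr (x.adj_and_add_eq_one hxv ha h).1
      have hbw : b = w ∨ G.Adj b w := by
        by_cases h : b = w
        · exact Or.inl h
        · exact Or.inr (y.adj_and_add_eq_one hb hyw h).1
      have hnab : ¬ (a = b ∨ G.Adj a b) := fun hab =>
        (not_or.mpr ⟨hne, hadj⟩) (hG.trans hv hbo hw (hG.trans hv hao hbo hva hab) hbw)
      rw [not_or] at hnab
      exact graph_edist_eq_of_not_adj ho hnab.1 hnab.2
    have key' : ((G.edist a o : ℕ∞) : ℝ≥0∞) + ((G.edist o b : ℕ∞) : ℝ≥0∞) ≤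
        ((G.edist a b : ℕ∞) : ℝ≥0∞) := by
      rw [← ENat.toENNReal_add]
      exact ENat.toENNReal_le.mpr key
    have h1 := edist_apex_le_add (o := o) x ha
    have h2 := edist_apex_le_add (o := o) y hb
    rw [edist_comm, SimpleGraph.edist_comm] at h2
    calc _ ≤ _ := add_le_add h1 h2
      _ = ENNReal.ofReal (1 - x.coord a) + (((G.edist a o : ℕ∞) : ℝ≥0∞) +
          ((G.edist o b : ℕ∞) : ℝ≥0∞)) + ENNReal.ofReal (1 - y.coord b) := by ring
      _ ≤ _ := by gcongr

/-- The supports of the two points lie in a clique. A vertex is within `1 + 1/2` of any point there.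
Two non-vertex points lie on edges with a common end, and the routes through this end and through
the other ends have total length at most 3, so the shorter one is at most `3 / 2`. -/
theorem edist_le_of_sameBlock (ho : ∀ v, v ≠ o → G.Adj o v) (hG : IsWindmill G o)
    {x y : MetricGraph G} (h : SameBlock o x y) : edist x y ≤ ENNReal.ofReal (3 / 2) := by
  have hclique : ∀ v w, x.coord v ≠ 0 → y.coord w ≠ 0 → v = w ∨ G.Adj v w := by
    intro v w hv hw
    by_cases hvo : v = o
    · by_cases hwo : w = o
      · exact Or.inl (hvo.trans hwo.symm)
      · exact Or.inr (hvo ▸ ho w hwo)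
    · by_cases hwo : w = o
      · exact Or.inr (hwo ▸ (ho v hvo).symm)
      · exact h v w hvo hwo hv hw
  have hone : ∀ (x y : MetricGraph G), (∀ v w, x.coord v ≠ 0 → y.coord w ≠ 0 →
      v = w ∨ G.Adj v w) → ∀ a, x.coord a = 1 → edist x y ≤ ENNReal.ofReal (3 / 2) := by
    intro x y hc a ha
    obtain ⟨b, hb⟩ := y.exists_half_le_coord
    have ha0 : x.coord a ≠ 0 := by rw [ha]; exact one_ne_zero
    have hb0 : y.coord b ≠ 0 := by linarith
    rcases hc a b ha0 hb0 with rfl | hab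
    · exact (edist_le_of_common ha0 hb0).trans (ENNReal.ofReal_le_ofReal (by linarith))
    · exact (edist_le_of_adj ha0 hb0 hab).trans (ENNReal.ofReal_le_ofReal (by linarith))
  by_cases hx : ∃ a, x.coord a = 1
  · obtain ⟨a, ha⟩ := hx
    exact hone x y hclique a ha
  by_cases hy : ∃ a, y.coord a = 1
  · obtain ⟨a, ha⟩ := hy
    rw [edist_comm]
    exact hone y x (fun v w hv hw => (hclique w v hw hv).imp Eq.symm SimpleGraph.Adj.symm) a ha
  push Not at hx hy
  -- Disjoint edges would span four pairwise adjacent vertices, at most one of them `o`; a vertex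
  -- other than `o` would then have two neighbours other than `o`.
  have hshare : ∃ c, x.coord c ≠ 0 ∧ y.coord c ≠ 0 := by
    obtain ⟨u, hu⟩ := x.exists_coord_ne_zero
    obtain ⟨u', huu, hu'⟩ := x.exists_ne_zero_of_ne_one (hx u)
    obtain ⟨w, hw⟩ := y.exists_coord_ne_zero
    obtain ⟨w', hww, hw'⟩ := y.exists_ne_zero_of_ne_one (hy w)
    by_contra! hne
    have a1 := (x.adj_and_add_eq_one hu hu' huu.symm).1
    have a2 := (y.adj_and_add_eq_one hw hw' hww.symm).1
    have b1 : u ≠ w := fun h => hw (h ▸ hne u hu)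
    have b2 : u ≠ w' := fun h => hw' (h ▸ hne u hu)
    have b3 : u' ≠ w := fun h => hw (h ▸ hne u' hu')
    have b4 : u' ≠ w' := fun h => hw' (h ▸ hne u' hu')
    have c1 := (hclique u w hu hw).resolve_left b1
    have c2 := (hclique u w' hu hw').resolve_left b2
    have c3 := (hclique u' w hu' hw).resolve_left b3
    have c4 := (hclique u' w' hu' hw').resolve_left b4
    by_cases d1 : u = o
    · have e1 : u' ≠ o := fun h => huu (h.trans d1.symm)
      exact hww (hG u' w' w e1 (fun h => b2 (d1.trans h.symm)) (fun h => b1 (d1.trans h.symm)) c4 c3)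
    by_cases d2 : w = o
    · have e1 : w' ≠ o := fun h => hww (h.trans d2.symm)
      exact huu (hG w' u' u e1 (fun h => b3 (h.trans d2.symm)) d1 c4.symm c2.symm)
    by_cases d3 : u' = o
    · exact hww (hG u w' w d1 (fun h => b4 (d3.trans h.symm)) d2 c2 c1)
    · exact huu (hG w u' u d2 d3 d1 c3.symm c1.symm)
  obtain ⟨c, hxc, hyc⟩ := hshare
  obtain ⟨a, hac, ha⟩ := x.exists_ne_zero_of_ne_one (hx c)
  obtain ⟨b, hbc, hb⟩ := y.exists_ne_zero_of_ne_one (hy c)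
  have h1 := (x.adj_and_add_eq_one ha hxc hac).2
  have h2 := (y.adj_and_add_eq_one hb hyc hbc).2
  -- The route through `c` has length `2 - (x_c + y_c)`; the one through `a` and `b` has length at
  -- most `1 + x_c + y_c`.
  rcases le_total (1 / 2) (x.coord c + y.coord c) with h3 | h3
  · exact (edist_le_of_common hxc hyc).trans (ENNReal.ofReal_le_ofReal (by linarith))
  · rcases hclique a b ha hb with rfl | hab
    · exact (edist_le_of_common ha hb).trans (ENNReal.ofReal_le_ofReal (by linarith))
    · exact (edist_le_of_adj ha hb hab).trans (ENNReal.ofReal_le_ofReal (by linarith))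

theorem graphDelta_le_of_isWindmill (ho : ∀ v, v ≠ o → G.Adj o v) (hG : IsWindmill G o) :
    graphDelta G ≤ 3 / 4 := by
  have h34 : (3 / 4 : ℝ≥0∞) = ENNReal.ofReal (3 / 4) := by
    rw [ENNReal.ofReal_div_of_pos (by norm_num)]
    simp
  have hfin := edist_ne_top_of_apex ho
  rw [h34]
  refine hyperbolicityConstant_le_of_cut_point hfin (vertexPoint G o) (SameBlock o)
    (fun x y => SameBlock.symm) (fun x q y hq => SameBlock.trans hG hq) ?_ ?_ ?_
  · intro x y h
    rw [edist_eq_of_not_sameBlock ho hG h, ENNReal.toReal_add (hfin _ _) (hfin _ _)]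
  · intro x
    refine ENNReal.toReal_le_of_le_ofReal (by norm_num) ((edist_apex_le ho x).trans_eq ?_)
    norm_num
  · intro x y h
    refine ENNReal.toReal_le_of_le_ofReal (by norm_num) ((edist_le_of_sameBlock ho hG h).trans_eq ?_)
    norm_num

/-- Each block of a star is a single edge at `o`, on which distance is the difference of the
distances to `o`. -/
theorem toReal_edist_of_sameBlock_star (ho : ∀ v, v ≠ o → G.Adj o v)
    (hG : ∀ u v, u ≠ o → v ≠ o → ¬ G.Adj u v) {x y : MetricGraph G} (h : SameBlock o x y) :
    (edist x y).toReal =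
      |(edist x (vertexPoint G o)).toReal - (edist y (vertexPoint G o)).toReal| := by
  have hfin := edist_ne_top_of_apex ho
  have hlow : ∀ z : MetricGraph G, 1 - z.coord o ≤ (edist z (vertexPoint G o)).toReal := by
    intro z
    have h1 := abs_coord_sub_le_edist z (vertexPoint G o) o
    rw [vertexPoint_coord_self, abs_sub_comm, abs_of_nonneg (by linarith [z.coord_le_one o])] at h1
    exact (ENNReal.ofReal_le_iff_le_toReal (hfin _ _)).mp h1
  have hup : ∀ (x y : MetricGraph G), SameBlock o x y →
      (edist x y).toReal ≤ |x.coord o - y.coord o| := by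
    intro x y h
    refine ENNReal.toReal_le_of_le_ofReal (abs_nonneg _) ?_
    by_cases hu : ∃ u, u ≠ o ∧ (x.coord u ≠ 0 ∨ y.coord u ≠ 0)
    · obtain ⟨u, huo, hu⟩ := hu
      have hsup : ∀ (z : MetricGraph G) v w, v ≠ o → w ≠ o → z.coord v ≠ 0 → z.coord w ≠ 0 →
          v = w := by
        intro z v w hv hw hv' hw'
        by_contra hvw
        exact hG v w hv hw (z.adj_and_add_eq_one hv' hw' hvw).1
      have hxy : ∀ v w, v ≠ o → w ≠ o → x.coord v ≠ 0 → y.coord w ≠ 0 → v = w :=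
        fun v w hv hw hv' hw' => (h v w hv hw hv' hw').resolve_right (hG v w hv hw)
      refine edist_le_of_onEdge (p := o) (q := u) ⟨ho u huo, fun w hw => ?_, fun w hw => ?_⟩
      · by_cases hwo : w = o
        · exact Or.inl hwo
        · rcases hu with hu | hu
          · exact Or.inr (hsup x w u hwo huo hw hu)
          · exact Or.inr (hxy w u hwo huo hw hu)
      · by_cases hwo : w = o
        · exact Or.inl hwo
        · rcases hu with hu | hu
          · exact Or.inr (hxy u w huo hwo hu hw).symm
          · exact Or.inr (hsup y w u hwo huo hw hu)
    · push Not at hu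
      rw [eq_vertexPoint (fun w hw => (hu w hw).1), ← eq_vertexPoint (fun w hw => (hu w hw).2),
        edist_self]
      exact zero_le
  have heq : ∀ z : MetricGraph G, (edist z (vertexPoint G o)).toReal = 1 - z.coord o := by
    intro z
    refine le_antisymm ?_ (hlow z)
    refine (hup z (vertexPoint G o) fun v w _ hw _ hw' =>
      absurd (vertexPoint_coord_of_ne hw) hw').trans_eq ?_
    rw [vertexPoint_coord_self, abs_sub_comm, abs_of_nonneg (by linarith [z.coord_le_one o])]
  apply le_antisymm
  · refine (hup x y h).trans_eq ?_
    rw [heq, heq, show 1 - x.coord o - (1 - y.coord o) = -(x.coord o - y.coord o) by ring, abs_neg]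
  · have h1 := toReal_edist_triangle hfin x y (vertexPoint G o)
    have h2 := toReal_edist_triangle hfin y x (vertexPoint G o)
    rw [edist_comm y x] at h2
    rw [abs_le]
    constructor <;> linarith

/-- In `d(x, y) = f x + f y - 2 m(x, y)`, `m` is the Gromov product based at `o`: the length of the
common part of the paths from `o`. Its ultrametric inequality yields the four-point condition. -/
theorem graphDelta_eq_zero_of_star (ho : ∀ v, v ≠ o → G.Adj o v)
    (hG : ∀ u v, u ≠ o → v ≠ o → ¬ G.Adj u v) : graphDelta G = 0 := by
  classical
  have hfin := edist_ne_top_of_apex ho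
  have hW : IsWindmill G o := fun v u w hv hu _ h _ => absurd h (hG v u hv hu)
  set f : MetricGraph G → ℝ := fun x => (edist x (vertexPoint G o)).toReal with hf
  have hf0 : ∀ x, 0 ≤ f x := fun x => ENNReal.toReal_nonneg
  set m : MetricGraph G → MetricGraph G → ℝ :=
    fun x y => if SameBlock o x y then min (f x) (f y) else 0 with hm
  have hd : ∀ x y, (edist x y).toReal = f x + f y - 2 * m x y := by
    intro x y
    by_cases h : SameBlock o x y
    · rw [toReal_edist_of_sameBlock_star ho hG h]
      simp only [hm, if_pos h]
      change |f x - f y| = _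
      rcases le_total (f x) (f y) with h1 | h1
      · rw [min_eq_left h1, abs_sub_comm, abs_of_nonneg (by linarith)]
        ring
      · rw [min_eq_right h1, abs_of_nonneg (by linarith)]
        ring
    · rw [edist_eq_of_not_sameBlock ho hW h, ENNReal.toReal_add (hfin _ _) (hfin _ _),
        edist_comm _ y]
      simp only [hm, if_neg h]
      change f x + f y = _
      ring
  have hm0 : ∀ x y, 0 ≤ m x y := by
    intro x y
    simp only [hm]
    split_ifs
    · exact le_min (hf0 x) (hf0 y)
    · exact le_rfl
  have hml : ∀ x y, m x y ≤ f x := by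
    intro x y
    simp only [hm]
    split_ifs
    · exact min_le_left _ _
    · exact hf0 x
  have hmr : ∀ x y, m x y ≤ f y := by
    intro x y
    simp only [hm]
    split_ifs
    · exact min_le_right _ _
    · exact hf0 y
  have hsymm : ∀ x y, m x y = m y x := by
    intro x y
    have h1 := hd x y
    have h2 := hd y x
    rw [edist_comm] at h1
    linarith
  have hultra : ∀ x q y, min (m x q) (m q y) ≤ m x y := by
    intro x q y
    by_cases h : SameBlock o x y
    · have h1 : m x y = min (f x) (f y) := if_pos h
      rw [h1]
      exact min_le_min (hml x q) (hmr q y)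
    · refine le_trans ?_ (hm0 x y)
      by_cases hq : q = vertexPoint G o
      · refine (min_le_left _ _).trans ((hmr x q).trans_eq ?_)
        simp [hf, hq]
      · by_cases h1 : SameBlock o x q
        · have h2 : ¬ SameBlock o q y := fun h2 => h (h1.trans hW hq h2)
          exact (min_le_right _ _).trans_eq (if_neg h2)
        · exact (min_le_left _ _).trans_eq (if_neg h1)
  refine hyperbolicityConstant_eq_zero_of_four_point hfin fun a b c e => ?_
  simp only [hd]
  -- Once the terms in `f` cancel, the claim is that `m a b + m c e` is at least the smaller of `m a
  -- c + m b e` and `m a e + m b c`. Each summand on the left is bounded through either intermediate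
  -- point.
  have u1 := hultra a c b
  have u2 := hultra a e b
  have u3 := hultra c a e
  have u4 := hultra c b e
  have s1 := hsymm c a
  have s2 := hsymm c b
  have s3 := hsymm e b
  rw [min_le_iff] at u1 u2 u3 u4
  rw [le_max_iff]
  by_contra! hcon
  obtain ⟨c1, c2⟩ := hcon
  rcases u1 with u1 | u1 <;> rcases u2 with u2 | u2 <;> rcases u3 with u3 | u3 <;>
    rcases u4 with u4 | u4 <;> linarith

end Apex

end JoinHyp

end

/-! ### Cones, joins and the classification -/

noncomputable section

namespace JoinHyp

section Main

variable {V : Type*} {G : SimpleGraph V} {o : V}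

theorem three_quarters_lt_one : (3 / 4 : ℝ≥0∞) < 1 := by
  refine (ENNReal.div_lt_iff (by simp) (by simp)).mpr ?_
  norm_num

theorem three_quarters_ne_zero : (3 / 4 : ℝ≥0∞) ≠ 0 := by
  simp

/-- A vertex `v` with two neighbours `u` and `w`, all different from `o`, gives the 4-cycle `o u v
w`. -/
theorem one_le_graphDelta_of_not_isWindmill (ho : ∀ v, v ≠ o → G.Adj o v)
    (hG : ¬ IsWindmill G o) : 1 ≤ graphDelta G := by
  unfold IsWindmill at hG
  push Not at hG
  obtain ⟨v, u, w, hv, hu, hw, hvu, hvw, hne⟩ := hG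
  exact one_le_graphDelta (ho u hu) hvu.symm hvw.symm (ho w hw) hv.symm hne

theorem graphDelta_eq_zero_iff_of_apex (ho : ∀ v, v ≠ o → G.Adj o v) :
    graphDelta G = 0 ↔ ∀ u v, u ≠ o → v ≠ o → ¬ G.Adj u v := by
  refine ⟨fun h u v hu hv huv => ?_, graphDelta_eq_zero_of_star ho⟩
  have h1 := three_quarters_le_graphDelta (ho u hu) huv (ho v hv)
  rw [h, nonpos_iff_eq_zero] at h1
  exact three_quarters_ne_zero h1

theorem graphDelta_eq_three_quarters_iff_of_apex (ho : ∀ v, v ≠ o → G.Adj o v) :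
    graphDelta G = 3 / 4 ↔ IsWindmill G o ∧ ∃ u v, u ≠ o ∧ v ≠ o ∧ G.Adj u v := by
  constructor
  · intro h
    constructor
    · by_contra hG
      have h1 := one_le_graphDelta_of_not_isWindmill ho hG
      rw [h] at h1
      exact absurd h1 (not_le.mpr three_quarters_lt_one)
    · by_contra! hG
      rw [graphDelta_eq_zero_of_star ho hG] at h
      exact three_quarters_ne_zero h.symm
  · rintro ⟨hG, u, v, hu, hv, huv⟩
    exact le_antisymm (graphDelta_le_of_isWindmill ho hG)
      (three_quarters_le_graphDelta (ho u hu) huv (ho v hv))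

theorem nonempty_iso_oneVertexGraph_iff [Nonempty V] :
    Nonempty (G ≃g oneVertexGraph) ↔ Subsingleton V := by
  constructor
  · rintro ⟨e⟩
    exact e.toEquiv.subsingleton
  · intro h
    obtain ⟨v⟩ := ‹Nonempty V›
    refine ⟨⟨⟨fun _ => 0, fun _ => v, fun _ => Subsingleton.elim _ _,
      fun _ => Subsingleton.elim _ _⟩, fun {a b} => ?_⟩⟩
    rw [Subsingleton.elim b a]
    simp

theorem supDegree_eq_one_iff :
    supDegree G = 1 ↔ (∀ v u w, G.Adj v u → G.Adj v w → u = w) ∧ ∃ u v, G.Adj u v := by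
  have hle : supDegree G ≤ 1 ↔ ∀ v u w, G.Adj v u → G.Adj v w → u = w := by
    unfold supDegree
    simp only [iSup_le_iff, Set.encard_le_one_iff, SimpleGraph.mem_neighborSet]
  have hge : 1 ≤ supDegree G ↔ ∃ u v, G.Adj u v := by
    rw [Order.one_le_iff_pos]
    unfold supDegree
    simp only [lt_iSup_iff, Set.encard_pos, Set.Nonempty, SimpleGraph.mem_neighborSet]
  rw [← hle, ← hge]
  exact ⟨fun h => ⟨h.le, h.ge⟩, fun h => le_antisymm h.1 h.2⟩

variable {W : Type*} {H : SimpleGraph W}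

@[simp] theorem graphJoin_adj_inl_inl {a b : V} :
    (graphJoin G H).Adj (Sum.inl a) (Sum.inl b) ↔ G.Adj a b := by
  simp [graphJoin]

@[simp] theorem graphJoin_adj_inr_inr {a b : W} :
    (graphJoin G H).Adj (Sum.inr a) (Sum.inr b) ↔ H.Adj a b := by
  simp [graphJoin]

@[simp] theorem graphJoin_adj_inl_inr {a : V} {b : W} :
    (graphJoin G H).Adj (Sum.inl a) (Sum.inr b) := by
  simp [graphJoin]

@[simp] theorem graphJoin_adj_inr_inl {a : V} {b : W} :
    (graphJoin G H).Adj (Sum.inr b) (Sum.inl a) := by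
  simp [graphJoin]

theorem eq_bot_of_subsingleton [Subsingleton V] (G : SimpleGraph V) : G = ⊥ := by
  ext a b
  simp [Subsingleton.elim a b]

theorem not_supDegree_eq_one_of_subsingleton [Subsingleton V] (G : SimpleGraph V) :
    supDegree G ≠ 1 := by
  rw [Ne, supDegree_eq_one_iff, eq_bot_of_subsingleton G]
  simp

theorem eq_bot_iff_forall_not_adj : H = ⊥ ↔ ∀ a b, ¬ H.Adj a b := by
  constructor
  · rintro rfl a b
    simp
  · intro h
    ext a b
    simp [h a b]

/-- The hyperbolicity constant of a graph that is `H` together with a dominating vertex. -/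
theorem graphDelta_cone (ho : ∀ v, v ≠ o → G.Adj o v) (i : W → V) (hi : ∀ v, v ≠ o ↔ ∃ a, i a = v)
    (hinj : Function.Injective i) (hadj : ∀ a b, G.Adj (i a) (i b) ↔ H.Adj a b) :
    (graphDelta G = 0 ↔ H = ⊥) ∧ (graphDelta G = 3 / 4 ↔ supDegree H = 1) := by
  have hio : ∀ a, i a ≠ o := fun a => (hi _).mpr ⟨a, rfl⟩
  rw [graphDelta_eq_zero_iff_of_apex ho, graphDelta_eq_three_quarters_iff_of_apex ho,
    supDegree_eq_one_iff, eq_bot_iff_forall_not_adj]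
  refine ⟨⟨fun h a b hab => h _ _ (hio a) (hio b) ((hadj a b).mpr hab), fun h u v hu hv => ?_⟩,
    and_congr ⟨fun h a b c hab hac => hinj (h _ _ _ (hio a) (hio b) (hio c) ((hadj a b).mpr hab)
      ((hadj a c).mpr hac)), fun h v u w hv hu hw => ?_⟩ ⟨?_, ?_⟩⟩
  · obtain ⟨a, rfl⟩ := (hi u).mp hu
    obtain ⟨b, rfl⟩ := (hi v).mp hv
    rw [hadj]
    exact h a b
  · obtain ⟨a, rfl⟩ := (hi v).mp hv
    obtain ⟨b, rfl⟩ := (hi u).mp hu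
    obtain ⟨c, rfl⟩ := (hi w).mp hw
    rw [hadj, hadj]
    exact fun h1 h2 => congrArg i (h a b c h1 h2)
  · rintro ⟨u, v, hu, hv, huv⟩
    obtain ⟨a, rfl⟩ := (hi u).mp hu
    obtain ⟨b, rfl⟩ := (hi v).mp hv
    exact ⟨a, b, (hadj a b).mp huv⟩
  · rintro ⟨a, b, hab⟩
    exact ⟨i a, i b, hio a, hio b, (hadj a b).mpr hab⟩

theorem graphDelta_join_of_subsingleton_left [Nonempty V] [Subsingleton V] (G : SimpleGraph V)
    (H : SimpleGraph W) : (graphDelta (graphJoin G H) = 0 ↔ H = ⊥) ∧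
      (graphDelta (graphJoin G H) = 3 / 4 ↔ supDegree H = 1) := by
  obtain ⟨o⟩ := ‹Nonempty V›
  have ho : ∀ v : V ⊕ W, v ≠ Sum.inl o ↔ ∃ a, Sum.inr a = v := by
    rintro (v | v)
    · simp [Subsingleton.elim v o]
    · simp
  refine graphDelta_cone (o := Sum.inl o) (fun v hv => ?_) Sum.inr ho Sum.inr_injective
    (fun a b => graphJoin_adj_inr_inr)
  obtain ⟨a, rfl⟩ := (ho v).mp hv
  exact graphJoin_adj_inl_inr

theorem graphDelta_join_of_subsingleton_right [Nonempty W] [Subsingleton W] (G : SimpleGraph V)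
    (H : SimpleGraph W) : (graphDelta (graphJoin G H) = 0 ↔ G = ⊥) ∧
      (graphDelta (graphJoin G H) = 3 / 4 ↔ supDegree G = 1) := by
  obtain ⟨o⟩ := ‹Nonempty W›
  have ho : ∀ v : V ⊕ W, v ≠ Sum.inr o ↔ ∃ a, Sum.inl a = v := by
    rintro (v | v)
    · simp
    · simp [Subsingleton.elim v o]
  refine graphDelta_cone (o := Sum.inr o) (fun v hv => ?_) Sum.inl ho Sum.inl_injective
    (fun a b => graphJoin_adj_inl_inl)
  obtain ⟨a, rfl⟩ := (ho v).mp hv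
  exact graphJoin_adj_inr_inl

/-- Two vertices from each side, taken alternately, form a 4-cycle. -/
theorem one_le_graphDelta_join [Nontrivial V] [Nontrivial W] (G : SimpleGraph V)
    (H : SimpleGraph W) : 1 ≤ graphDelta (graphJoin G H) := by
  obtain ⟨a, d, had⟩ := exists_pair_ne V
  obtain ⟨b, c, hbc⟩ := exists_pair_ne W
  exact one_le_graphDelta (a := Sum.inl a) (b := Sum.inr b) (c := Sum.inr c) (d := Sum.inl d)
    graphJoin_adj_inl_inr graphJoin_adj_inr_inl graphJoin_adj_inr_inl graphJoin_adj_inl_inr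
    (by simpa using had) (by simpa using hbc)

end Main

end JoinHyp

end

theorem mainTheorem6 {V₁ : Type*} {V₂ : Type*} [Nonempty V₁] [Nonempty V₂]
    (G₁ : SimpleGraph V₁) (G₂ : SimpleGraph V₂) :
    (JoinHyp.graphDelta (JoinHyp.graphJoin G₁ G₂) = 0 ↔
      (G₁ = ⊥ ∧ G₂ = ⊥) ∧
        (Nonempty (G₁ ≃g JoinHyp.oneVertexGraph) ∨ Nonempty (G₂ ≃g JoinHyp.oneVertexGraph))) ∧
    (JoinHyp.graphDelta (JoinHyp.graphJoin G₁ G₂) = 3 / 4 ↔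
      (Nonempty (G₁ ≃g JoinHyp.oneVertexGraph) ∧ JoinHyp.supDegree G₂ = 1) ∨
        (Nonempty (G₂ ≃g JoinHyp.oneVertexGraph) ∧ JoinHyp.supDegree G₁ = 1)) := by
  simp only [JoinHyp.nonempty_iso_oneVertexGraph_iff]
  rcases subsingleton_or_nontrivial V₁ with h1 | h1
  · obtain ⟨h2, h3⟩ := JoinHyp.graphDelta_join_of_subsingleton_left G₁ G₂
    have h4 := JoinHyp.eq_bot_of_subsingleton G₁
    -- This excludes the alternative with the roles exchanged, which would require an edge in the
    -- one-vertex factor.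
    have h5 := JoinHyp.not_supDegree_eq_one_of_subsingleton G₁
    rw [h2, h3]
    tauto
  rcases subsingleton_or_nontrivial V₂ with h1' | h1'
  · obtain ⟨h2, h3⟩ := JoinHyp.graphDelta_join_of_subsingleton_right G₁ G₂
    have h4 := JoinHyp.eq_bot_of_subsingleton G₂
    have h5 := JoinHyp.not_supDegree_eq_one_of_subsingleton G₂
    rw [h2, h3]
    tauto
  -- With two vertices on each side, all four statements are false.
  · have h2 := JoinHyp.one_le_graphDelta_join G₁ G₂
    have h3 := not_subsingleton V₁
    have h4 := not_subsingleton V₂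
    have h5 : JoinHyp.graphDelta (JoinHyp.graphJoin G₁ G₂) ≠ 0 := fun h => by
      rw [h] at h2
      exact absurd h2 (by simp)
    have h6 : JoinHyp.graphDelta (JoinHyp.graphJoin G₁ G₂) ≠ 3 / 4 := fun h => by
      rw [h] at h2
      exact absurd h2 (not_le.mpr JoinHyp.three_quarters_lt_one)
    tauto
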